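/- We work over $\mathbb C$. For a power series $\xi\in\mathbb C[[x]]$ with $\xi(0)=0$, a real number $t\ge 1$ and a nonzero $f\in\mathbb C[x,y]$, expand $f(x,y)=\sum a_{ij}x^i(y-\xi(x))^j$ and put $v_{\xi,t}(f)=\min\{i+tj\mid a_{ij}\neq0\}$ (and $v_{\xi,t}(0)=\infty$). Let $\mu_d(\xi,t)=\max\{v_{\xi,t}(f)\mid 0\ne f\in\mathbb C[x,y],\ \deg f\le d\}$ and $\hat\mu(\xi,t)=\lim_{d\to\infty}\mu_d(\xi,t)/d$. A property holds for *very general* $\xi$ if there are countably many nonzero polynomials, each in finitely many of the coefficients $a_1,a_2,\dots$ of $\xi=\sum_{i\ge1} a_ix^i$, such that the property holds for every $\xi$ at which none of these polynomials vanishes. Let $\hat\mu(t)=\inf_{\xi}\hat\mu(\xi,t)$, the infimum being over all $\xi$ with $\xi(0)=0$. (1) Let $\xi(0)=0$ and $t\ge1$. If $f\in\mathbb C[x,y]$ is irreducible with $v_{\xi,t}(f)>\deg(f)\sqrt t$, then $f$ divides every $g\in\mathbb C[x,y]$ with $v_{\xi,t}(g)>\deg(g)\sqrt t$, and $v_{\xi,t}(f)=\hat\mu(\xi,t)\deg(f)$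 (that is, $f$ computes $\hat\mu(\xi,t)$). Moreover, if $\hat\mu(\xi,t)>\sqrt t$, then there is an irreducible $f\in\mathbb C[x,y]$ with $v_{\xi,t}(f)>\deg(f)\sqrt t$. (2) For very general $\xi$, one has $\hat\mu(\xi,t)=\hat\mu(t)$ for all real $t\ge1$. (3) Let $d,r$ be natural numbers and let $m_1,n_1,\dots,m_r,n_r$ be natural numbers with $\gcd(m_i,n_i)=1$ for all $i$. Assume that for very general $\xi$ there is an irreducible $f\in\mathbb C[x,y]$ with $\deg f=d$ that decomposes in $\mathbb C[[x,y]]$ as a product $f=f_1\cdots f_r$ of $r$ irreducible series with $\operatorname{ord}_x f_i(x,\xi(x))=m_i$ and $\operatorname{ord} f_i(x,y)=n_i$. Put $\mu_f(t)=\sum_{i=1}^r\min(n_it,m_i)$. Then for all real $t\ge1$ one has $\hat\mu(t)\ge\mu_f(t)/d$, with equality at all $t\ge 1$ such that $\mu_f(t)>d\sqrt t$. -/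

import Mathlib

open Filter Topology

noncomputable section

/-- The substitution `y = ξ(x) + z`, with `x`, `y` the variables `0`, `1` of `ℂ[x, y]`: it sends
`f(x, y)` to `f(x, ξ(x) + z)`, a polynomial in `z` with coefficients in `ℂ⟦x⟧`. -/
def expansion (ξ : PowerSeries ℂ) :
    MvPolynomial (Fin 2) ℂ →ₐ[ℂ] Polynomial (PowerSeries ℂ) :=
  MvPolynomial.aeval ![Polynomial.C PowerSeries.X, Polynomial.X + Polynomial.C ξ]

/-- The coefficient `a_{ij}` in the expansion `f(x, y) = ∑ a_{ij} x^i (y - ξ(x))^j`. -/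
def expansionCoeff (ξ : PowerSeries ℂ) (f : MvPolynomial (Fin 2) ℂ) (i j : ℕ) : ℂ :=
  PowerSeries.coeff i ((expansion ξ f).coeff j)

/-- The value `v_{ξ,t}(f) = min {i + t j | a_{ij} ≠ 0}` of a nonzero polynomial `f` under the
quasimonomial valuation `v_{ξ,t}`, for `t ≥ 1`. (The value of `f = 0` is `∞` by convention; the
real number returned here in that case is `0` and it is never used.) -/
def quasiVal (ξ : PowerSeries ℂ) (t : ℝ) (f : MvPolynomial (Fin 2) ℂ) : ℝ :=
  sInf {s : ℝ | ∃ i j : ℕ, expansionCoeff ξ f i j ≠ 0 ∧ s = i + t * j}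

/-- `μ_d(ξ, t) = max {v_{ξ,t}(f) | f ≠ 0, deg f ≤ d}`. -/
def muDeg (ξ : PowerSeries ℂ) (t : ℝ) (d : ℕ) : ℝ :=
  sSup {s : ℝ | ∃ f : MvPolynomial (Fin 2) ℂ, f ≠ 0 ∧ f.totalDegree ≤ d ∧ s = quasiVal ξ t f}

/-- `μ̂(ξ, t) = lim_{d → ∞} μ_d(ξ, t) / d`. -/
def muHat (ξ : PowerSeries ℂ) (t : ℝ) : ℝ :=
  limUnder atTop (fun d : ℕ => muDeg ξ t d / d)

/-- A property of series `ξ ∈ ℂ⟦x⟧` with `ξ(0) = 0` holds for very general `ξ` if it holds outside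
a countable union of proper Zariski closed conditions on jets: there are countably many nonzero
polynomials in the coefficients `a₁, a₂, …` of `ξ` (each involving finitely many of them; variable
`i` stands for `a_{i+1}`) such that the property holds as soon as none of them vanishes at `ξ`. -/
def VeryGeneral (P : PowerSeries ℂ → Prop) : Prop :=
  ∃ F : ℕ → MvPolynomial ℕ ℂ, (∀ k, F k ≠ 0) ∧
    ∀ ξ : PowerSeries ℂ, PowerSeries.constantCoeff ξ = 0 →
      (∀ k, MvPolynomial.eval (fun i => PowerSeries.coeff (i + 1) ξ) (F k) ≠ 0) → P ξ

/-- `μ̂(t)`: the minimal value of `μ̂(ξ, t)` over all series `ξ` with `ξ(0) = 0` (which is the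
common value at very general `ξ`). -/
def muHatGen (t : ℝ) : ℝ :=
  ⨅ ξ : {ξ : PowerSeries ℂ // PowerSeries.constantCoeff ξ = 0}, muHat ξ.1 t

/-- `f` decomposes in `ℂ⟦x, y⟧` as a product `f = f₁ ⋯ f_r` of `r` irreducible series such that
`ord_x f_i(x, ξ(x)) = m_i` and `ord f_i(x, y) = n_i`. -/
def HasBranchData (ξ : PowerSeries ℂ) (f : MvPolynomial (Fin 2) ℂ) {r : ℕ} (m n : Fin r → ℕ) :
    Prop :=
  ∃ φ : Fin r → MvPowerSeries (Fin 2) ℂ,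
    (f : MvPowerSeries (Fin 2) ℂ) = ∏ i, φ i ∧
    ∀ i, Irreducible (φ i) ∧
      PowerSeries.order (MvPowerSeries.subst ![(PowerSeries.X : PowerSeries ℂ), ξ] (φ i) :
        PowerSeries ℂ) = m i ∧
      MvPowerSeries.order (φ i) = n i

/-- The tropical polynomial `μ_f(t) = ∑ min(n_i t, m_i)`. -/
def tropicalMu {r : ℕ} (m n : Fin r → ℕ) (t : ℝ) : ℝ :=
  ∑ i, min ((n i : ℝ) * t) (m i : ℝ)

end

/-! Well-definedness: the values are bounded and the limit defining `μ̂(ξ, t)` exists. -/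

theorem exists_expansionCoeff_ne_zero (ξ : PowerSeries ℂ) {f : MvPolynomial (Fin 2) ℂ}
    (hf : f ≠ 0) : ∃ i j : ℕ, i + j ≤ f.totalDegree ∧ expansionCoeff ξ f i j ≠ 0 := by
  classical
  let Φ : MvPolynomial (Fin 2) ℂ →ₐ[ℂ] Polynomial (Polynomial ℂ) :=
    MvPolynomial.aeval ![Polynomial.C Polynomial.X, Polynomial.X]
  have hΦ : ∀ (f : MvPolynomial (Fin 2) ℂ) (s : Fin 2 →₀ ℕ),
      ((Φ f).coeff (s 1)).coeff (s 0) = f.coeff s := by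
    intro f s
    induction f using MvPolynomial.induction_on' with
    | monomial u a =>
      have h1 : Φ (MvPolynomial.monomial u a) =
          Polynomial.C (Polynomial.C a * Polynomial.X ^ u 0) * Polynomial.X ^ u 1 := by
        simp only [Φ, MvPolynomial.aeval_monomial]
        rw [Finsupp.prod_fintype _ _ (by simp)]
        simp [Fin.prod_univ_two, mul_assoc, IsScalarTower.algebraMap_apply ℂ (Polynomial ℂ)
          (Polynomial (Polynomial ℂ))]
      rw [h1, Polynomial.coeff_C_mul_X_pow, MvPolynomial.coeff_monomial]
      have h2 : u = s ↔ s 1 = u 1 ∧ s 0 = u 0 := by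
        constructor
        · rintro rfl; exact ⟨rfl, rfl⟩
        · rintro ⟨h, h'⟩; ext i; fin_cases i
          · exact h'.symm
          · exact h.symm
      by_cases h3 : s 1 = u 1 <;> by_cases h4 : s 0 = u 0 <;>
        simp [h2, h3, h4, Polynomial.coeff_X_pow]
    | add p q hp hq => simp [hp, hq]
  have hΦ0 : Φ f ≠ 0 := by
    intro h
    apply hf
    ext s
    rw [← hΦ, h]; simp
  have hexp : expansion ξ f =
      Polynomial.taylor ξ ((Φ f).map (Polynomial.coeToPowerSeries.ringHom (R := ℂ))) := by
    clear hΦ0 hf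
    induction f using MvPolynomial.induction_on with
    | C a =>
      simp [expansion, Φ, IsScalarTower.algebraMap_apply ℂ (Polynomial ℂ)
        (Polynomial (Polynomial ℂ)), IsScalarTower.algebraMap_apply ℂ (PowerSeries ℂ)
        (Polynomial (PowerSeries ℂ))]
    | add p q hp hq => simp [hp, hq]
    | mul_X p i hp =>
      rw [map_mul, map_mul, Polynomial.map_mul, Polynomial.taylor_mul, hp]
      congr 1
      fin_cases i <;> simp [expansion, Φ]
  set P := Φ f with hP
  have hinj : Function.Injective (Polynomial.coeToPowerSeries.ringHom (R := ℂ)) := by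
    intro a b h
    simpa using h
  have hlead : (expansion ξ f).coeff P.natDegree =
      ((P.leadingCoeff : Polynomial ℂ) : PowerSeries ℂ) := by
    have h1 : (P.map (Polynomial.coeToPowerSeries.ringHom (R := ℂ))).natDegree = P.natDegree :=
      Polynomial.natDegree_map_eq_of_injective hinj P
    rw [hexp, ← h1, Polynomial.coeff_taylor_natDegree,
      Polynomial.leadingCoeff_map_of_injective hinj]
    simp
  have hne : P.leadingCoeff.coeff P.leadingCoeff.natDegree ≠ 0 := by
    simpa using hΦ0
  refine ⟨P.leadingCoeff.natDegree, P.natDegree, ?_, ?_⟩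
  · let s : Fin 2 →₀ ℕ := Finsupp.equivFunOnFinite.symm ![P.leadingCoeff.natDegree, P.natDegree]
    have hs : f.coeff s ≠ 0 := by
      rw [← hΦ]; exact hne
    have := MvPolynomial.le_totalDegree (MvPolynomial.mem_support_iff.mpr hs)
    rw [Finsupp.sum_fintype _ _ (by simp)] at this
    simpa [s, Fin.sum_univ_two] using this
  · rw [expansionCoeff, hlead, Polynomial.coeff_coe]
    exact hne

theorem quasiVal_le (ξ : PowerSeries ℂ) {t : ℝ} (ht : 1 ≤ t) {f : MvPolynomial (Fin 2) ℂ}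
    {i j : ℕ} (h : expansionCoeff ξ f i j ≠ 0) : quasiVal ξ t f ≤ i + t * j := by
  refine csInf_le ⟨0, ?_⟩ ⟨i, j, h, rfl⟩
  rintro s ⟨a, b, -, rfl⟩
  positivity

theorem le_quasiVal (ξ : PowerSeries ℂ) {t : ℝ} {f : MvPolynomial (Fin 2) ℂ} (hf : f ≠ 0)
    {c : ℝ} (h : ∀ i j : ℕ, expansionCoeff ξ f i j ≠ 0 → c ≤ i + t * j) :
    c ≤ quasiVal ξ t f := by
  obtain ⟨i, j, -, hij⟩ := exists_expansionCoeff_ne_zero ξ hf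
  refine le_csInf ⟨_, i, j, hij, rfl⟩ ?_
  rintro s ⟨a, b, hab, rfl⟩
  exact h a b hab

theorem quasiVal_le_totalDegree (ξ : PowerSeries ℂ) {t : ℝ} (ht : 1 ≤ t)
    {f : MvPolynomial (Fin 2) ℂ} (hf : f ≠ 0) : quasiVal ξ t f ≤ t * f.totalDegree := by
  obtain ⟨i, j, hd, hij⟩ := exists_expansionCoeff_ne_zero ξ hf
  refine (quasiVal_le ξ ht hij).trans ?_
  have h1 : (i : ℝ) + j ≤ f.totalDegree := by exact_mod_cast hd
  have h2 : (0 : ℝ) ≤ i := by positivity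
  nlinarith

theorem quasiVal_add_le_mul (ξ : PowerSeries ℂ) {t : ℝ} (ht : 1 ≤ t)
    {f g : MvPolynomial (Fin 2) ℂ} (hf : f ≠ 0) (hg : g ≠ 0) :
    quasiVal ξ t f + quasiVal ξ t g ≤ quasiVal ξ t (f * g) := by
  refine le_quasiVal ξ (mul_ne_zero hf hg) ?_
  intro i j hij
  rw [expansionCoeff, map_mul, Polynomial.coeff_mul, map_sum] at hij
  obtain ⟨p, hp, hp0⟩ := Finset.exists_ne_zero_of_sum_ne_zero hij
  rw [PowerSeries.coeff_mul] at hp0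
  obtain ⟨q, hq, hq0⟩ := Finset.exists_ne_zero_of_sum_ne_zero hp0
  rw [Finset.HasAntidiagonal.mem_antidiagonal] at hp hq
  have h1 := quasiVal_le ξ ht (f := f) (i := q.1) (j := p.1) (left_ne_zero_of_mul hq0)
  have h2 := quasiVal_le ξ ht (f := g) (i := q.2) (j := p.2) (right_ne_zero_of_mul hq0)
  have h3 : (q.1 : ℝ) + q.2 = i := by exact_mod_cast hq
  have h4 : (p.1 : ℝ) + p.2 = j := by exact_mod_cast hp
  rw [← h3, ← h4]
  linarith

theorem quasiVal_le_muDeg (ξ : PowerSeries ℂ) {t : ℝ} (ht : 1 ≤ t) {d : ℕ}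
    {f : MvPolynomial (Fin 2) ℂ} (hf : f ≠ 0) (hd : f.totalDegree ≤ d) :
    quasiVal ξ t f ≤ muDeg ξ t d := by
  refine le_csSup ⟨t * d, ?_⟩ ⟨f, hf, hd, rfl⟩
  rintro s ⟨g, hg, hgd, rfl⟩
  refine (quasiVal_le_totalDegree ξ ht hg).trans ?_
  gcongr

theorem muDeg_le (ξ : PowerSeries ℂ) {t : ℝ} {d : ℕ} {c : ℝ}
    (h : ∀ f : MvPolynomial (Fin 2) ℂ, f ≠ 0 → f.totalDegree ≤ d → quasiVal ξ t f ≤ c) :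
    muDeg ξ t d ≤ c := by
  refine csSup_le ⟨_, 1, one_ne_zero, by simp, rfl⟩ ?_
  rintro s ⟨f, hf, hd, rfl⟩
  exact h f hf hd

theorem tendsto_muHat (ξ : PowerSeries ℂ) {t : ℝ} (ht : 1 ≤ t) :
    Tendsto (fun d : ℕ => muDeg ξ t d / d) atTop (𝓝 (muHat ξ t)) := by
  have hsub : Subadditive (fun d => -muDeg ξ t d) := by
    intro a b
    have : muDeg ξ t a ≤ muDeg ξ t (a + b) - muDeg ξ t b := by
      refine muDeg_le ξ fun f hf hfd => ?_
      have : muDeg ξ t b ≤ muDeg ξ t (a + b) - quasiVal ξ t f := by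
        refine muDeg_le ξ fun g hg hgd => ?_
        have h1 := quasiVal_add_le_mul ξ ht hf hg
        have h2 := quasiVal_le_muDeg ξ ht (d := a + b) (mul_ne_zero hf hg)
          ((MvPolynomial.totalDegree_mul f g).trans (by omega))
        linarith
      linarith
    show -muDeg ξ t (a + b) ≤ -muDeg ξ t a + -muDeg ξ t b
    linarith
  have hb : BddBelow (Set.range fun d : ℕ => -muDeg ξ t d / d) := by
    refine ⟨-t, ?_⟩
    rintro _ ⟨d, rfl⟩
    have h : muDeg ξ t d ≤ t * d := by
      refine muDeg_le ξ fun f hf hfd => (quasiVal_le_totalDegree ξ ht hf).trans ?_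
      gcongr
    rcases Nat.eq_zero_or_pos d with rfl | hd
    · simp; linarith
    · have : (0 : ℝ) < d := by exact_mod_cast hd
      show -t ≤ -muDeg ξ t d / d
      rw [le_div_iff₀ this]
      linarith
  have h := (hsub.tendsto_lim hb).neg
  refine tendsto_nhds_limUnder ⟨-hsub.lim, h.congr fun d => ?_⟩
  simp [neg_div]

/-! Write a = v(f), b = v(g) for v = v_{ξ,t}. Everything in (1) rests on two facts: v is
multiplicative, and v(f) v(g) ≤ t deg f deg g when f and g have no common factor
(`quasiVal_mul_quasiVal_le`). For the first, the substitution y ↦ y + ξ(x) turns v into the monomial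
valuation of weights (1, t), which is multiplicative because minimal monomials multiply.

The second is Bézout's inequality, proved by counting instead of by local intersection numbers. The
exponents of weight below a + b number about (a + b)²/2t, and polynomials of large degree realise
all coefficients there. The combinations f u + g v of suitable degree have codimension at most deg f
deg g, while multiples of f and of g account for only about b²/2t and a²/2t of these coefficients.
The surplus ab/t is thus at most deg f deg g up to an error linear in a and b, which disappears on
passing to powers of f and g.

If v(f) > deg f √t with f irreducible, any g with the same property must share a factor with f.
Additivity of value and degree over factorisations then gives the rest of (1).

For (2), having only the zero polynomial of degree at most d in the kernel of finitely many
coefficient functionals is an open condition on ξ, and only countably many such conditions occur.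
Hence very general ξ minimise every μ_d simultaneously.

For (3), a vertex of a Newton polygon off the axes forces a factorisation, so the minimal weight of
an irreducible branch is attained on an axis and equals min(n t, m). Then v(f) = μ_f(t), and (1)
applies at a single very general ξ. -/

/-! ### Monomial valuations on ℂ⟦x, z⟧ -/

/-- The value of a power series in two variables under the monomial valuation of weights
`(1, t)`. -/
noncomputable def monVal (t : ℝ) (F : MvPowerSeries (Fin 2) ℂ) : ℝ :=
  sInf {s : ℝ | ∃ e : Fin 2 →₀ ℕ, MvPowerSeries.coeff e F ≠ 0 ∧ s = e 0 + t * e 1}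

/-- `e` is the exponent of the smallest monomial of `F` when monomials are ordered by their
`(1, t)`-weight first and by their degree in the second variable next. -/
def IsLexMin (t : ℝ) (F : MvPowerSeries (Fin 2) ℂ) (e : Fin 2 →₀ ℕ) : Prop :=
  MvPowerSeries.coeff e F ≠ 0 ∧ ∀ e' : Fin 2 →₀ ℕ, MvPowerSeries.coeff e' F ≠ 0 →
    (e 0 + t * e 1 : ℝ) < e' 0 + t * e' 1 ∨
      ((e 0 + t * e 1 : ℝ) = e' 0 + t * e' 1 ∧ e 1 ≤ e' 1)

theorem finite_weight_le {t : ℝ} (ht : 0 < t) (c : ℝ) :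
    {e : Fin 2 →₀ ℕ | (e 0 + t * e 1 : ℝ) ≤ c}.Finite := by
  let b : Fin 2 →₀ ℕ := Finsupp.equivFunOnFinite.symm ![⌈c⌉₊, ⌈c / t⌉₊]
  refine (Set.finite_Iic b).subset fun e he => ?_
  have he : (e 0 + t * e 1 : ℝ) ≤ c := he
  have h0 : (0 : ℝ) ≤ e 0 := by positivity
  have h1 : (0 : ℝ) ≤ t * e 1 := by positivity
  intro i
  fin_cases i
  · have : (e 0 : ℝ) ≤ ⌈c⌉₊ := by linarith [Nat.le_ceil c]
    simpa [b] using (by exact_mod_cast this : e 0 ≤ ⌈c⌉₊)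
  · have : (e 1 : ℝ) ≤ ⌈c / t⌉₊ := by
      refine le_trans ?_ (Nat.le_ceil _)
      rw [le_div_iff₀ ht]; linarith
    simpa [b] using (by exact_mod_cast this : e 1 ≤ ⌈c / t⌉₊)

theorem exists_isLexMin {t : ℝ} (ht : 0 < t) {F : MvPowerSeries (Fin 2) ℂ} (hF : F ≠ 0) :
    ∃ e, IsLexMin t F e := by
  obtain ⟨e₀, he₀⟩ : ∃ e, MvPowerSeries.coeff e F ≠ 0 := by
    by_contra! h
    exact hF (MvPowerSeries.ext fun e => by simpa using h e)
  let S : Set (Fin 2 →₀ ℕ) :=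
    {e | (e 0 + t * e 1 : ℝ) ≤ e₀ 0 + t * e₀ 1 ∧ MvPowerSeries.coeff e F ≠ 0}
  have hS : S.Finite := (finite_weight_le ht (e₀ 0 + t * e₀ 1)).subset fun e he => he.1
  obtain ⟨e, he, hmin⟩ := Set.exists_min_image S
    (fun e => toLex ((e 0 + t * e 1 : ℝ), e 1)) hS ⟨e₀, le_rfl, he₀⟩
  refine ⟨e, he.2, fun e' he' => ?_⟩
  by_cases h : (e' 0 + t * e' 1 : ℝ) ≤ e₀ 0 + t * e₀ 1
  · exact Prod.Lex.toLex_le_toLex.mp (hmin e' ⟨h, he'⟩)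
  · left; linarith [he.1]

theorem IsLexMin.le {t : ℝ} {F : MvPowerSeries (Fin 2) ℂ} {e : Fin 2 →₀ ℕ} (h : IsLexMin t F e)
    {e' : Fin 2 →₀ ℕ} (he' : MvPowerSeries.coeff e' F ≠ 0) :
    (e 0 + t * e 1 : ℝ) ≤ e' 0 + t * e' 1 :=
  (h.2 e' he').elim le_of_lt fun h => h.1.le

theorem IsLexMin.monVal_eq {t : ℝ} {F : MvPowerSeries (Fin 2) ℂ} {e : Fin 2 →₀ ℕ}
    (h : IsLexMin t F e) : monVal t F = e 0 + t * e 1 := by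
  refine IsLeast.csInf_eq ⟨⟨e, h.1, rfl⟩, ?_⟩
  rintro s ⟨e', he', rfl⟩
  exact h.le he'

/-- For rational t several monomials may share the least weight. Weight together with the second
exponent determines the monomial, so after the tie-break only one pair contributes to the
coefficient at `a + b`, and nothing cancels. -/
theorem IsLexMin.mul {t : ℝ} {F G : MvPowerSeries (Fin 2) ℂ} {a b : Fin 2 →₀ ℕ}
    (hF : IsLexMin t F a) (hG : IsLexMin t G b) : IsLexMin t (F * G) (a + b) := by
  classical
  constructor
  · rw [MvPowerSeries.coeff_mul, Finset.sum_eq_single (a, b)]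
    · exact mul_ne_zero hF.1 hG.1
    · rintro ⟨p, q⟩ hpq hne
      rw [Finset.HasAntidiagonal.mem_antidiagonal] at hpq
      have hpq : p + q = a + b := hpq
      by_contra hc
      have h1 := hF.2 p (left_ne_zero_of_mul hc)
      have h2 := hG.2 q (right_ne_zero_of_mul hc)
      have e0 : p 0 + q 0 = a 0 + b 0 := by simpa using DFunLike.congr_fun hpq 0
      have e1 : p 1 + q 1 = a 1 + b 1 := by simpa using DFunLike.congr_fun hpq 1
      have e0' : (p 0 + q 0 : ℝ) = a 0 + b 0 := by exact_mod_cast e0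
      have e1' : (p 1 + q 1 : ℝ) = a 1 + b 1 := by exact_mod_cast e1
      have e2 : (p 0 + t * p 1 : ℝ) + (q 0 + t * q 1) = (a 0 + t * a 1) + (b 0 + t * b 1) := by
        linear_combination e0' + t * e1'
      obtain ⟨h1, h1'⟩ := h1.resolve_left fun h => by
        rcases h2 with h2 | h2 <;> linarith [h2]
      obtain ⟨h2, h2'⟩ := h2.resolve_left fun h => by linarith
      have e3 : p 1 = a 1 := by omega
      have e4 : q 1 = b 1 := by omega
      have e5 : p 0 = a 0 := by
        rw [e3] at h1; exact_mod_cast (by linarith : (p 0 : ℝ) = a 0)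
      have e6 : q 0 = b 0 := by omega
      apply hne
      ext i <;> fin_cases i <;> assumption
    · intro h; simp at h
  · intro e he
    rw [MvPowerSeries.coeff_mul] at he
    obtain ⟨⟨p, q⟩, hpq, hne⟩ := Finset.exists_ne_zero_of_sum_ne_zero he
    rw [Finset.HasAntidiagonal.mem_antidiagonal] at hpq
    obtain rfl : p + q = e := hpq
    have h1 := hF.2 p (left_ne_zero_of_mul hne)
    have h2 := hG.2 q (right_ne_zero_of_mul hne)
    simp only [Finsupp.add_apply, Nat.cast_add]
    rcases h1 with h1 | ⟨h1, h1'⟩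
    · left
      rcases h2 with h2 | ⟨h2, -⟩ <;> linarith
    · rcases h2 with h2 | ⟨h2, h2'⟩
      · left; linarith
      · right; exact ⟨by linarith, by omega⟩

theorem monVal_mul {t : ℝ} (ht : 0 < t) {F G : MvPowerSeries (Fin 2) ℂ} (hF : F ≠ 0)
    (hG : G ≠ 0) : monVal t (F * G) = monVal t F + monVal t G := by
  obtain ⟨a, ha⟩ := exists_isLexMin ht hF
  obtain ⟨b, hb⟩ := exists_isLexMin ht hG
  rw [ha.monVal_eq, hb.monVal_eq, (ha.mul hb).monVal_eq]
  simp only [Finsupp.add_apply, Nat.cast_add]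
  ring

theorem monVal_one {t : ℝ} (ht : 0 < t) : monVal t 1 = 0 := by
  have h := monVal_mul ht (one_ne_zero (α := MvPowerSeries (Fin 2) ℂ)) one_ne_zero
  rw [mul_one] at h
  linarith

theorem monVal_prod {t : ℝ} (ht : 0 < t) {ι : Type*} (s : Finset ι)
    (F : ι → MvPowerSeries (Fin 2) ℂ) (hF : ∀ i ∈ s, F i ≠ 0) :
    monVal t (∏ i ∈ s, F i) = ∑ i ∈ s, monVal t (F i) := by
  classical
  induction s using Finset.induction_on with
  | empty => simpa using monVal_one ht
  | insert a s ha ih =>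
    rw [Finset.forall_mem_insert] at hF
    rw [Finset.prod_insert ha, Finset.sum_insert ha,
      monVal_mul ht hF.1 (Finset.prod_ne_zero_iff.mpr hF.2), ih hF.2]

/-! ### The shear along ξ, and multiplicativity of v_{ξ,t} -/

/-- The substitution `y ↦ y + ξ(x)` of power series in two variables. -/
noncomputable def shear (ξ : PowerSeries ℂ) : Fin 2 → MvPowerSeries (Fin 2) ℂ :=
  ![MvPowerSeries.X 0, MvPowerSeries.X 1 + PowerSeries.subst (MvPowerSeries.X 0) ξ]

theorem constantCoeff_subst_X_zero {ξ : PowerSeries ℂ} (hξ : PowerSeries.constantCoeff ξ = 0) :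
    MvPowerSeries.constantCoeff
      (PowerSeries.subst (MvPowerSeries.X 0 : MvPowerSeries (Fin 2) ℂ) ξ) = 0 := by
  apply PowerSeries.constantCoeff_subst_eq_zero _ _ hξ
  simp

theorem constantCoeff_shear {ξ : PowerSeries ℂ} (hξ : PowerSeries.constantCoeff ξ = 0) (i : Fin 2) :
    MvPowerSeries.constantCoeff (shear ξ i) = 0 := by
  fin_cases i
  · simp [shear]
  · simp [shear, constantCoeff_subst_X_zero hξ]

theorem hasSubst_shear {ξ : PowerSeries ℂ} (hξ : PowerSeries.constantCoeff ξ = 0) :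
    MvPowerSeries.HasSubst (shear ξ) :=
  MvPowerSeries.hasSubst_of_constantCoeff_zero (constantCoeff_shear hξ)

theorem subst_shear_neg {ξ : PowerSeries ℂ} (hξ : PowerSeries.constantCoeff ξ = 0)
    (F : MvPowerSeries (Fin 2) ℂ) :
    MvPowerSeries.subst (shear ξ) (MvPowerSeries.subst (shear (-ξ)) F) = F := by
  have hξ' : PowerSeries.constantCoeff (-ξ) = 0 := by simp [hξ]
  rw [MvPowerSeries.subst_comp_subst_apply (hasSubst_shear hξ') (hasSubst_shear hξ)]
  have h0 : PowerSeries.HasSubst (MvPowerSeries.X 0 : MvPowerSeries (Fin 2) ℂ) :=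
    PowerSeries.HasSubst.X 0
  have : (fun s => MvPowerSeries.subst (shear ξ) (shear (-ξ) s)) = MvPowerSeries.X := by
    funext s
    have hX : MvPowerSeries.subst (shear ξ) (MvPowerSeries.X 0 : MvPowerSeries (Fin 2) ℂ) =
        MvPowerSeries.X 0 := by
      rw [MvPowerSeries.subst_X (hasSubst_shear hξ)]; rfl
    fin_cases s
    · exact hX
    · show MvPowerSeries.subst (shear ξ) (MvPowerSeries.X 1 +
        PowerSeries.subst (MvPowerSeries.X 0) (-ξ)) = MvPowerSeries.X 1
      rw [MvPowerSeries.subst_add (hasSubst_shear hξ), MvPowerSeries.subst_X (hasSubst_shear hξ)]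
      have h1 : MvPowerSeries.subst (shear ξ)
          (PowerSeries.subst (MvPowerSeries.X 0 : MvPowerSeries (Fin 2) ℂ) (-ξ)) =
          -PowerSeries.subst (MvPowerSeries.X 0 : MvPowerSeries (Fin 2) ℂ) ξ := by
        rw [PowerSeries.subst, MvPowerSeries.subst_comp_subst_apply h0.const (hasSubst_shear hξ)]
        simp only [hX]
        have := PowerSeries.subst_sub h0 0 ξ
        rw [zero_sub] at this
        rw [← PowerSeries.subst_def, this]
        have h00 : PowerSeries.subst (MvPowerSeries.X 0 : MvPowerSeries (Fin 2) ℂ)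
            (0 : PowerSeries ℂ) = 0 := by
          rw [← PowerSeries.coe_substAlgHom h0, map_zero]
        rw [h00, zero_sub]
      rw [h1]
      simp [shear]
  rw [this, MvPowerSeries.subst_self]
  rfl

/-- The automorphism `F(x, y) ↦ F(x, y + ξ(x))` of `ℂ⟦x, y⟧`. -/
noncomputable def shearEquiv (ξ : PowerSeries ℂ) (hξ : PowerSeries.constantCoeff ξ = 0) :
    MvPowerSeries (Fin 2) ℂ ≃* MvPowerSeries (Fin 2) ℂ where
  toFun := MvPowerSeries.subst (shear ξ)
  invFun := MvPowerSeries.subst (shear (-ξ))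
  left_inv F := by
    have := subst_shear_neg (ξ := -ξ) (by simp [hξ]) F
    rwa [neg_neg] at this
  right_inv := subst_shear_neg hξ
  map_mul' F G := MvPowerSeries.subst_mul (hasSubst_shear hξ) F G

theorem le_order_subst_shear {ξ : PowerSeries ℂ} (hξ : PowerSeries.constantCoeff ξ = 0)
    (F : MvPowerSeries (Fin 2) ℂ) :
    F.order ≤ (MvPowerSeries.subst (shear ξ) F).order := by
  refine le_trans ?_ (MvPowerSeries.le_order_subst (hasSubst_shear hξ) F)
  have h : 1 ≤ ⨅ i, (shear ξ i).order := by
    refine le_iInf fun i => ?_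
    rw [MvPowerSeries.one_le_order_iff_constCoeff_eq_zero]
    exact constantCoeff_shear hξ i
  exact le_mul_of_one_le_left bot_le h

/-- Substituting series without constant term cannot lower the order; the inverse shear gives the
other inequality. -/
theorem order_subst_shear {ξ : PowerSeries ℂ} (hξ : PowerSeries.constantCoeff ξ = 0)
    (F : MvPowerSeries (Fin 2) ℂ) :
    (MvPowerSeries.subst (shear ξ) F).order = F.order := by
  refine le_antisymm ?_ (le_order_subst_shear hξ F)
  have hξ' : PowerSeries.constantCoeff (-ξ) = 0 := by simp [hξ]
  refine (le_order_subst_shear hξ' _).trans_eq ?_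
  exact congrArg _ ((shearEquiv ξ hξ).symm_apply_apply F)

/-- A polynomial in `z` with coefficients in `ℂ⟦x⟧`, viewed as a power series in `x, z`. -/
noncomputable def toBivariate : Polynomial (PowerSeries ℂ) →+* MvPowerSeries (Fin 2) ℂ :=
  Polynomial.eval₂RingHom
    (PowerSeries.substAlgHom (R := ℂ) (PowerSeries.HasSubst.X (S := ℂ) (0 : Fin 2))).toRingHom
    (MvPowerSeries.X 1)

theorem coeff_toBivariate (P : Polynomial (PowerSeries ℂ)) (e : Fin 2 →₀ ℕ) :
    MvPowerSeries.coeff e (toBivariate P) = PowerSeries.coeff (e 0) (P.coeff (e 1)) := by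
  classical
  induction P using Polynomial.induction_on' with
  | add p q hp hq => simp [hp, hq]
  | monomial n c =>
    have h : toBivariate (Polynomial.monomial n c) =
        PowerSeries.subst (MvPowerSeries.X 0 : MvPowerSeries (Fin 2) ℂ) c *
          MvPowerSeries.X 1 ^ n := by
      simp [toBivariate, Polynomial.eval₂_monomial, PowerSeries.coe_substAlgHom]
    rw [h, MvPowerSeries.X_pow_eq, MvPowerSeries.coeff_mul_monomial,
      PowerSeries.coeff_subst_single, Polynomial.coeff_monomial]
    by_cases hn : n = e 1
    · rw [if_pos (by simp [hn]), if_pos (by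
        ext i; fin_cases i <;> simp [hn]), if_pos hn]
      simp
    · rw [if_neg hn]
      split_ifs with h1 h2
      · exfalso
        apply hn
        have h3 := DFunLike.congr_fun h2 1
        have h4 := h1 1
        simp at h3 h4
        omega
      · simp
      · simp

theorem toBivariate_expansion {ξ : PowerSeries ℂ} (hξ : PowerSeries.constantCoeff ξ = 0)
    (f : MvPolynomial (Fin 2) ℂ) :
    toBivariate (expansion ξ f) = MvPowerSeries.subst (shear ξ) (f : MvPowerSeries (Fin 2) ℂ) := by
  rw [← MvPowerSeries.coe_substAlgHom (hasSubst_shear hξ)]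
  induction f using MvPolynomial.induction_on with
  | C a =>
    have h1 : expansion ξ (MvPolynomial.C a) = Polynomial.C (PowerSeries.C a) := by
      simp [expansion, IsScalarTower.algebraMap_apply ℂ (PowerSeries ℂ)
        (Polynomial (PowerSeries ℂ))]
    rw [h1, MvPolynomial.coe_C, MvPowerSeries.coe_substAlgHom, MvPowerSeries.subst_C]
    simp only [toBivariate, Polynomial.coe_eval₂RingHom, Polynomial.eval₂_C]
    show PowerSeries.substAlgHom _ (PowerSeries.C a) = _
    rw [PowerSeries.coe_substAlgHom]
    exact PowerSeries.subst_C a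
  | add p q hp hq => rw [map_add, map_add, hp, hq, MvPolynomial.coe_add, map_add]
  | mul_X p i hp =>
    rw [map_mul, map_mul, hp, MvPolynomial.coe_mul, map_mul, MvPolynomial.coe_X,
      MvPowerSeries.substAlgHom_X]
    congr 1
    have h0 : PowerSeries.HasSubst (MvPowerSeries.X 0 : MvPowerSeries (Fin 2) ℂ) :=
      PowerSeries.HasSubst.X 0
    fin_cases i
    · simp [expansion, toBivariate, shear, PowerSeries.subst_X h0, PowerSeries.coe_substAlgHom]
    · simp [expansion, toBivariate, shear, PowerSeries.coe_substAlgHom]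

theorem expansionCoeff_eq_coeff {ξ : PowerSeries ℂ} (hξ : PowerSeries.constantCoeff ξ = 0)
    (f : MvPolynomial (Fin 2) ℂ) (e : Fin 2 →₀ ℕ) :
    expansionCoeff ξ f (e 0) (e 1) =
      MvPowerSeries.coeff e (MvPowerSeries.subst (shear ξ) (f : MvPowerSeries (Fin 2) ℂ)) := by
  rw [← toBivariate_expansion hξ, coeff_toBivariate, expansionCoeff]

theorem quasiVal_eq_monVal {ξ : PowerSeries ℂ} (hξ : PowerSeries.constantCoeff ξ = 0) (t : ℝ)
    (f : MvPolynomial (Fin 2) ℂ) :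
    quasiVal ξ t f =
      monVal t (MvPowerSeries.subst (shear ξ) (f : MvPowerSeries (Fin 2) ℂ)) := by
  unfold quasiVal monVal
  congr 1
  ext s
  constructor
  · rintro ⟨i, j, hij, rfl⟩
    refine ⟨Finsupp.equivFunOnFinite.symm ![i, j], ?_, by simp⟩
    rw [← expansionCoeff_eq_coeff hξ]
    simpa using hij
  · rintro ⟨e, he, rfl⟩
    exact ⟨e 0, e 1, by rwa [expansionCoeff_eq_coeff hξ], rfl⟩

theorem subst_shear_ne_zero {ξ : PowerSeries ℂ} (hξ : PowerSeries.constantCoeff ξ = 0)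
    {F : MvPowerSeries (Fin 2) ℂ} (hF : F ≠ 0) : MvPowerSeries.subst (shear ξ) F ≠ 0 := by
  intro h
  rw [← MvPowerSeries.order_eq_top_iff, order_subst_shear hξ,
    MvPowerSeries.order_eq_top_iff] at h
  exact hF h

theorem quasiVal_mul {ξ : PowerSeries ℂ} (hξ : PowerSeries.constantCoeff ξ = 0) {t : ℝ}
    (ht : 1 ≤ t) {f g : MvPolynomial (Fin 2) ℂ} (hf : f ≠ 0) (hg : g ≠ 0) :
    quasiVal ξ t (f * g) = quasiVal ξ t f + quasiVal ξ t g := by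
  have hcoe : ∀ {p : MvPolynomial (Fin 2) ℂ}, p ≠ 0 → (p : MvPowerSeries (Fin 2) ℂ) ≠ 0 :=
    fun hp h => hp (MvPolynomial.coe_eq_zero_iff.mp h)
  rw [quasiVal_eq_monVal hξ, MvPolynomial.coe_mul, MvPowerSeries.subst_mul (hasSubst_shear hξ),
    monVal_mul (by linarith) (subst_shear_ne_zero hξ (hcoe hf))
      (subst_shear_ne_zero hξ (hcoe hg)), ← quasiVal_eq_monVal hξ, ← quasiVal_eq_monVal hξ]

/-! ### Counting exponents below a weight and polynomials up to a degree -/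

/-- The exponents `(j, i)` of the monomials `x^i z^j` of `(1, t)`-weight less than `c`. -/
noncomputable def belowWeight (t c : ℝ) : Finset (Σ _ : ℕ, ℕ) :=
  (Finset.range ⌈c / t⌉₊).sigma fun j => Finset.range ⌈c - t * j⌉₊

theorem mem_belowWeight {t : ℝ} (ht : 0 < t) {c : ℝ} {i j : ℕ} :
    (⟨j, i⟩ : Σ _ : ℕ, ℕ) ∈ belowWeight t c ↔ (i : ℝ) + t * j < c := by
  simp only [belowWeight, Finset.mem_sigma, Finset.mem_range, Nat.lt_ceil, lt_div_iff₀ ht]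
  have : (0 : ℝ) ≤ i := by positivity
  constructor
  · rintro ⟨-, h⟩; linarith
  · intro h; constructor <;> linarith

theorem sum_range_sub_mul (t c : ℝ) (J : ℕ) :
    ∑ j ∈ Finset.range J, (c - t * j) = c * J - t * J * (J - 1) / 2 := by
  induction J with
  | zero => simp
  | succ J ih => rw [Finset.sum_range_succ, ih]; push_cast; ring

/-- The main term is the area of the triangle with legs c and c/t. Only the leading constant matters
for the Bézout bound: the matching upper bound `card_belowWeight_le` has an error linear in c. -/
theorem le_card_belowWeight {t : ℝ} (ht : 1 ≤ t) {c : ℝ} (hc : 0 ≤ c) :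
    c ^ 2 / (2 * t) ≤ (belowWeight t c).card := by
  have ht0 : 0 < t := by linarith
  rw [belowWeight, Finset.card_sigma]
  simp only [Finset.card_range]
  set J := ⌈c / t⌉₊ with hJ
  have h1 : c / t ≤ J := Nat.le_ceil _
  have h2 : (J : ℝ) < c / t + 1 := Nat.ceil_lt_add_one (by positivity)
  have h3 : ∑ j ∈ Finset.range J, (c - t * j) ≤ ∑ j ∈ Finset.range J, (⌈c - t * j⌉₊ : ℝ) :=
    Finset.sum_le_sum fun j _ => Nat.le_ceil _
  rw [sum_range_sub_mul] at h3
  push_cast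
  refine le_trans ?_ h3
  obtain ⟨u, rfl⟩ : ∃ u, c = t * u := ⟨c / t, by field_simp⟩
  have h4 : t * u / t = u := by field_simp
  rw [h4] at h1 h2
  have h5 : (t * u) ^ 2 / (2 * t) = t * (u ^ 2 / 2) := by field_simp
  have hu : 0 ≤ u := by
    by_contra h
    push Not at h
    nlinarith
  rw [h5]
  -- Rounding c/t = u up to J moves it by at most 1; the quadratic in J then exceeds u²/2 by half of
  -- this product, plus u/2.
  have h6 : 0 ≤ ((J : ℝ) - u) * (1 - (J - u)) := mul_nonneg (by linarith) (by linarith)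
  have h7 : u ^ 2 / 2 ≤ u * J - J * (J - 1) / 2 := by nlinarith
  nlinarith

theorem card_belowWeight_le {t : ℝ} (ht : 1 ≤ t) {c : ℝ} (hc : 0 ≤ c) :
    ((belowWeight t c).card : ℝ) ≤ c ^ 2 / (2 * t) + 2 * c + t + 1 := by
  have ht0 : 0 < t := by linarith
  rw [belowWeight, Finset.card_sigma]
  simp only [Finset.card_range]
  set J := ⌈c / t⌉₊ with hJ
  have h1 : c / t ≤ J := Nat.le_ceil _
  have h2 : (J : ℝ) < c / t + 1 := Nat.ceil_lt_add_one (by positivity)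
  have h3 : ∑ j ∈ Finset.range J, (⌈c - t * j⌉₊ : ℝ) ≤
      ∑ j ∈ Finset.range J, ((c - t * j) + 1) := by
    refine Finset.sum_le_sum fun j hj => (Nat.ceil_lt_add_one ?_).le
    rw [Finset.mem_range, hJ, Nat.lt_ceil, lt_div_iff₀ ht0] at hj
    linarith
  rw [Finset.sum_add_distrib, sum_range_sub_mul] at h3
  simp only [Finset.sum_const, Finset.card_range, nsmul_eq_mul, mul_one] at h3
  push_cast
  refine h3.trans ?_
  obtain ⟨u, rfl⟩ : ∃ u, c = t * u := ⟨c / t, by field_simp⟩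
  have h4 : t * u / t = u := by field_simp
  rw [h4] at h1 h2
  have h5 : (t * u) ^ 2 / (2 * t) = t * (u ^ 2 / 2) := by field_simp
  have hu : 0 ≤ u := by
    by_contra h
    push Not at h
    nlinarith
  rw [h5]
  have h7 : u * J - J * (J - 1) / 2 ≤ u ^ 2 / 2 + u / 2 + 1 := by
    nlinarith [sq_nonneg ((J : ℝ) - u), sq_nonneg ((J : ℝ) - u - 1)]
  nlinarith

theorem finrank_restrictTotalDegree_fin_two (N : ℕ) :
    (Module.finrank ℂ (MvPolynomial.restrictTotalDegree (Fin 2) ℂ N) : ℝ) =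
      (N + 1) * (N + 2) / 2 := by
  let b : Module.Basis {n : Fin 2 →₀ ℕ | (n.sum fun _ e => e) ≤ N} ℂ
      (MvPolynomial.restrictTotalDegree (Fin 2) ℂ N) :=
    MvPolynomial.basisRestrictSupport ℂ _
  let E : {n : Fin 2 →₀ ℕ | (n.sum fun _ e => e) ≤ N} ≃
      (Finset.range (N + 1)).sigma fun j => Finset.range (N + 1 - j) :=
    { toFun := fun n => ⟨⟨n.1 1, n.1 0⟩, by
        have h : (n.1.sum fun _ e => e) ≤ N := n.2
        rw [Finsupp.sum_fintype _ _ (by simp), Fin.sum_univ_two] at h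
        simp only [Finset.mem_sigma, Finset.mem_range]
        omega⟩
      invFun := fun s => ⟨Finsupp.equivFunOnFinite.symm ![s.1.2, s.1.1], by
        have h := s.2
        simp only [Finset.mem_sigma, Finset.mem_range] at h
        simp [Finsupp.sum_fintype, Fin.sum_univ_two]
        omega⟩
      left_inv := fun n => by
        ext i; fin_cases i <;> simp
      right_inv := fun s => by
        ext <;> simp }
  rw [Module.finrank_eq_card_basis (b.reindex E), Fintype.card_coe, Finset.card_sigma]
  simp only [Finset.card_range]
  have h : ∀ M ≤ N + 1, ∑ j ∈ Finset.range M, ((N + 1 - j : ℕ) : ℝ) =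
      M * (N + 1) - M * (M - 1) / 2 := by
    intro M
    induction M with
    | zero => simp
    | succ M ih =>
      intro hM
      rw [Finset.sum_range_succ, ih (by omega), Nat.cast_sub (by omega)]
      push_cast; ring
  push_cast
  rw [h (N + 1) le_rfl]
  push_cast; ring

/-! ### A Bézout inequality by dimension count -/

theorem finrank_map_mulLeft {f : MvPolynomial (Fin 2) ℂ} (hf : f ≠ 0)
    (p : Submodule ℂ (MvPolynomial (Fin 2) ℂ)) :
    Module.finrank ℂ (p.map (LinearMap.mulLeft ℂ f)) = Module.finrank ℂ p :=
  (Submodule.equivMapOfInjective _ (fun _ _ h => mul_left_cancel₀ hf h) p).finrank_eq.symm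

/-- Elements of degree at most `deg f + deg g + K` of the form `f u + g v` with `u, v` of the
expected degrees. -/
noncomputable def combos (f g : MvPolynomial (Fin 2) ℂ) (K : ℕ) :
    Submodule ℂ (MvPolynomial (Fin 2) ℂ) :=
  (MvPolynomial.restrictTotalDegree (Fin 2) ℂ (g.totalDegree + K)).map (LinearMap.mulLeft ℂ f) ⊔
    (MvPolynomial.restrictTotalDegree (Fin 2) ℂ (f.totalDegree + K)).map (LinearMap.mulLeft ℂ g)

theorem combos_le (f g : MvPolynomial (Fin 2) ℂ) (K : ℕ) :
    combos f g K ≤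
      MvPolynomial.restrictTotalDegree (Fin 2) ℂ (f.totalDegree + g.totalDegree + K) := by
  refine sup_le ?_ ?_
  · rintro _ ⟨u, hu, rfl⟩
    rw [SetLike.mem_coe, MvPolynomial.mem_restrictTotalDegree] at hu
    rw [MvPolynomial.mem_restrictTotalDegree]
    exact (MvPolynomial.totalDegree_mul f u).trans (by omega)
  · rintro _ ⟨u, hu, rfl⟩
    rw [SetLike.mem_coe, MvPolynomial.mem_restrictTotalDegree] at hu
    rw [MvPolynomial.mem_restrictTotalDegree]
    exact (MvPolynomial.totalDegree_mul g u).trans (by omega)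

/-- A common multiple of f and g is f g w, so the two summands meet at most in the multiples with
deg w ≤ K. With N(k) = (k+1)(k+2)/2, a = deg f and b = deg g, the claim is N(a+b+K) − N(a+K) −
N(b+K) + N(K) = ab. -/
theorem finrank_le_finrank_combos {f g : MvPolynomial (Fin 2) ℂ} (hf : f ≠ 0) (hg : g ≠ 0)
    (hfg : IsRelPrime f g) (K : ℕ) :
    (Module.finrank ℂ (MvPolynomial.restrictTotalDegree (Fin 2) ℂ
      (f.totalDegree + g.totalDegree + K)) : ℝ) ≤
      Module.finrank ℂ (combos f g K) + f.totalDegree * g.totalDegree := by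
  set U := (MvPolynomial.restrictTotalDegree (Fin 2) ℂ (g.totalDegree + K)).map
    (LinearMap.mulLeft ℂ f) with hU
  set V := (MvPolynomial.restrictTotalDegree (Fin 2) ℂ (f.totalDegree + K)).map
    (LinearMap.mulLeft ℂ g) with hV
  have h1 : Module.finrank ℂ (U ⊔ V : Submodule ℂ _) + Module.finrank ℂ (U ⊓ V : Submodule ℂ _) =
      Module.finrank ℂ U + Module.finrank ℂ V := Submodule.finrank_sup_add_finrank_inf_eq U V
  have h2 : U ⊓ V ≤
      (MvPolynomial.restrictTotalDegree (Fin 2) ℂ K).map (LinearMap.mulLeft ℂ (f * g)) := by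
    rintro h ⟨⟨u, hu, rfl⟩, ⟨v, hv, huv⟩⟩
    rw [SetLike.mem_coe, MvPolynomial.mem_restrictTotalDegree] at hu hv
    simp only [LinearMap.mulLeft_apply] at huv ⊢
    obtain ⟨w, hw⟩ := hfg.mul_dvd (Dvd.intro u rfl) (Dvd.intro v huv)
    refine ⟨w, ?_, hw.symm⟩
    rw [SetLike.mem_coe, MvPolynomial.mem_restrictTotalDegree]
    rcases eq_or_ne w 0 with rfl | hw0
    · simp
    have h3 : u = g * w := mul_left_cancel₀ hf (by rw [hw, mul_assoc])
    rw [h3, MvPolynomial.totalDegree_mul_of_isDomain hg hw0] at hu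
    omega
  have h3 := Submodule.finrank_mono h2
  rw [finrank_map_mulLeft (mul_ne_zero hf hg)] at h3
  rw [hU, hV, finrank_map_mulLeft hf, finrank_map_mulLeft hg, ← hU, ← hV] at h1
  have h4 : Module.finrank ℂ (combos f g K) = Module.finrank ℂ (U ⊔ V : Submodule ℂ _) := rfl
  have h1' : (Module.finrank ℂ (combos f g K) : ℝ) + Module.finrank ℂ (U ⊓ V : Submodule ℂ _) =
      Module.finrank ℂ (MvPolynomial.restrictTotalDegree (Fin 2) ℂ (g.totalDegree + K)) +
      Module.finrank ℂ (MvPolynomial.restrictTotalDegree (Fin 2) ℂ (f.totalDegree + K)) := by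
    rw [h4]; exact_mod_cast h1
  have h3' : (Module.finrank ℂ (U ⊓ V : Submodule ℂ _) : ℝ) ≤
      Module.finrank ℂ (MvPolynomial.restrictTotalDegree (Fin 2) ℂ K) := by exact_mod_cast h3
  rw [finrank_restrictTotalDegree_fin_two] at h3' ⊢
  rw [finrank_restrictTotalDegree_fin_two, finrank_restrictTotalDegree_fin_two] at h1'
  push_cast at h1' h3' ⊢
  nlinarith

section LinearAlgebra

variable {k E V V' : Type*} [Field k] [AddCommGroup E] [Module k E] [AddCommGroup V] [Module k V]
  [AddCommGroup V'] [Module k V']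

theorem finrank_map_add_finrank_inf_ker (φ : E →ₗ[k] V) (p : Submodule k E)
    [FiniteDimensional k p] :
    Module.finrank k (p.map φ) + Module.finrank k (p ⊓ LinearMap.ker φ : Submodule k E) =
      Module.finrank k p := by
  have h := LinearMap.finrank_range_add_finrank_ker (φ.domRestrict p)
  rw [LinearMap.range_domRestrict] at h
  rw [← h, LinearMap.domRestrict, LinearMap.ker_comp,
    ← Submodule.finrank_map_subtype_eq p, Submodule.map_comap_subtype]

/-- A linear map cannot increase the codimension of p in q, since the kernel on p is contained in
the kernel on q. -/
theorem finrank_map_add_finrank_le (φ : E →ₗ[k] V) {p q : Submodule k E} [FiniteDimensional k q]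
    (h : p ≤ q) :
    Module.finrank k (q.map φ) + Module.finrank k p ≤
      Module.finrank k (p.map φ) + Module.finrank k q := by
  have : FiniteDimensional k p := Submodule.finiteDimensional_of_le h
  have h1 := finrank_map_add_finrank_inf_ker φ p
  have h2 := finrank_map_add_finrank_inf_ker φ q
  have h3 : Module.finrank k (p ⊓ LinearMap.ker φ : Submodule k E) ≤
      Module.finrank k (q ⊓ LinearMap.ker φ : Submodule k E) :=
    Submodule.finrank_mono (inf_le_inf_right _ h)
  omega

theorem finrank_range_le_of_ker_le [FiniteDimensional k V] (φ : E →ₗ[k] V) (ψ : E →ₗ[k] V')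
    (h : LinearMap.ker φ ≤ LinearMap.ker ψ) :
    Module.finrank k (LinearMap.range ψ) ≤ Module.finrank k V := by
  have e := φ.quotKerEquivRange
  have : Module.Finite k (E ⧸ LinearMap.ker φ) := Module.Finite.equiv e.symm
  have h1 := LinearMap.finrank_range_le ((LinearMap.ker φ).liftQ ψ h)
  rw [Submodule.range_liftQ] at h1
  rw [e.finrank_eq] at h1
  exact h1.trans (Submodule.finrank_le _)

end LinearAlgebra

/-- The coefficients of the expansion of a polynomial at finitely many exponents `(j, i)`. -/
noncomputable def coeffsAt (ξ : PowerSeries ℂ) (S : Finset (Σ _ : ℕ, ℕ)) :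
    MvPolynomial (Fin 2) ℂ →ₗ[ℂ] (S → ℂ) where
  toFun f s := expansionCoeff ξ f s.1.2 s.1.1
  map_add' f g := by ext s; simp [expansionCoeff]
  map_smul' c f := by ext s; simp [expansionCoeff]

theorem coeffsAt_apply (ξ : PowerSeries ℂ) (S : Finset (Σ _ : ℕ, ℕ)) (f : MvPolynomial (Fin 2) ℂ)
    (s : S) : coeffsAt ξ S f s = expansionCoeff ξ f s.1.2 s.1.1 := rfl

/-- x^i (y − ξ)^j would do but is not a polynomial. Truncating ξ at order L changes the expansion
only by multiples of x^L, invisible on S once L exceeds every x-exponent occurring there. -/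
theorem exists_coeffsAt_eq_single (ξ : PowerSeries ℂ) (S : Finset (Σ _ : ℕ, ℕ)) (s : S) :
    ∃ f, coeffsAt ξ S f = Pi.single s 1 := by
  classical
  obtain ⟨L, hL⟩ : ∃ L, ∀ u ∈ S, u.2 < L :=
    ⟨S.sup (fun u => u.2) + 1, fun u hu => Nat.lt_succ_of_le (Finset.le_sup (f := fun u => u.2) hu)⟩
  let g : MvPolynomial (Fin 2) ℂ := Polynomial.aeval (MvPolynomial.X 0) (PowerSeries.trunc L ξ)
  have hg : expansion ξ g =
      Polynomial.C ((PowerSeries.trunc L ξ : Polynomial ℂ) : PowerSeries ℂ) := by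
    simp only [g]
    generalize PowerSeries.trunc L ξ = p
    induction p using Polynomial.induction_on' with
    | add p q hp hq => simp [hp, hq]
    | monomial n a =>
      rw [← Polynomial.C_mul_X_pow_eq_monomial]
      simp [expansion, IsScalarTower.algebraMap_apply ℂ (PowerSeries ℂ)
        (Polynomial (PowerSeries ℂ))]
  obtain ⟨η, hη⟩ : PowerSeries.X ^ L ∣
      ξ - ((PowerSeries.trunc L ξ : Polynomial ℂ) : PowerSeries ℂ) := by
    rw [PowerSeries.X_pow_dvd_iff]
    intro m hm
    simp [PowerSeries.coeff_trunc, hm]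
  refine ⟨MvPolynomial.X 0 ^ s.1.2 * (MvPolynomial.X 1 - g) ^ s.1.1, ?_⟩
  have h1 : expansion ξ (MvPolynomial.X 0 ^ s.1.2 * (MvPolynomial.X 1 - g) ^ s.1.1) =
      Polynomial.C (PowerSeries.X ^ s.1.2) *
        (Polynomial.X + Polynomial.C (PowerSeries.X ^ L * η)) ^ s.1.1 := by
    rw [← hη, map_mul, map_pow, map_pow, map_sub, hg]
    simp [expansion, add_sub_assoc]
  obtain ⟨Q, hQ⟩ : Polynomial.C (PowerSeries.X ^ L) ∣
      (Polynomial.X + Polynomial.C (PowerSeries.X ^ L * η)) ^ s.1.1 -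
        (Polynomial.X : Polynomial (PowerSeries ℂ)) ^ s.1.1 := by
    refine dvd_trans ?_ (sub_dvd_pow_sub_pow _ _ _)
    rw [add_sub_cancel_left, map_mul]
    exact dvd_mul_right _ _
  rw [sub_eq_iff_eq_add] at hQ
  ext u
  rw [coeffsAt_apply, expansionCoeff, h1, hQ, mul_add, ← mul_assoc, ← map_mul, ← pow_add,
    Polynomial.coeff_add, Polynomial.coeff_C_mul, Polynomial.coeff_C_mul, map_add,
    Polynomial.coeff_X_pow, PowerSeries.coeff_X_pow_mul',
    if_neg (by have := hL u.1 u.2; omega), zero_add, Pi.single_apply]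
  by_cases hu : u = s
  · subst hu; simp
  · rw [if_neg hu]
    split_ifs with h
    · rw [mul_one, PowerSeries.coeff_X_pow, if_neg]
      intro h'
      exact hu (Subtype.ext (Sigma.ext h (heq_of_eq h')))
    · simp

theorem exists_map_coeffsAt_eq_top (ξ : PowerSeries ℂ) (S : Finset (Σ _ : ℕ, ℕ)) :
    ∃ K, ∀ N, K ≤ N →
      (MvPolynomial.restrictTotalDegree (Fin 2) ℂ N).map (coeffsAt ξ S) = ⊤ := by
  classical
  choose f hf using exists_coeffsAt_eq_single ξ S
  refine ⟨Finset.univ.sup fun s => (f s).totalDegree, fun N hN => ?_⟩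
  rw [eq_top_iff, ← (Pi.basisFun ℂ S).span_eq, Submodule.span_le]
  rintro _ ⟨s, rfl⟩
  refine ⟨f s, ?_, by rw [hf, Pi.basisFun_apply]⟩
  rw [SetLike.mem_coe, MvPolynomial.mem_restrictTotalDegree]
  exact (Finset.le_sup (f := fun s => (f s).totalDegree) (Finset.mem_univ s)).trans hN

/-- If the coefficients of g below weight c − v(f) vanish, then v(f g) ≥ c. So the coefficients of f
g below c depend only on those of g below c − v(f). -/
theorem finrank_map_map_mulLeft_le (ξ : PowerSeries ℂ) {t : ℝ} (ht : 1 ≤ t)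
    {f : MvPolynomial (Fin 2) ℂ} (hf : f ≠ 0) (c : ℝ)
    (p : Submodule ℂ (MvPolynomial (Fin 2) ℂ)) :
    Module.finrank ℂ ((p.map (LinearMap.mulLeft ℂ f)).map (coeffsAt ξ (belowWeight t c))) ≤
      (belowWeight t (c - quasiVal ξ t f)).card := by
  have ht0 : 0 < t := by linarith
  have h := finrank_range_le_of_ker_le (coeffsAt ξ (belowWeight t (c - quasiVal ξ t f)))
    (coeffsAt ξ (belowWeight t c) ∘ₗ LinearMap.mulLeft ℂ f) ?_
  · rw [Module.finrank_fintype_fun_eq_card, Fintype.card_coe] at h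
    refine le_trans (Submodule.finrank_mono ?_) h
    rw [← Submodule.map_comp]
    exact LinearMap.map_le_range
  · intro g hg
    rw [LinearMap.mem_ker] at hg ⊢
    rcases eq_or_ne g 0 with rfl | hg0
    · simp
    ext ⟨⟨j, i⟩, hs⟩
    by_contra hne
    have hne : expansionCoeff ξ (f * g) i j ≠ 0 := hne
    rw [mem_belowWeight ht0] at hs
    have h1 := quasiVal_le ξ ht hne
    have h2 := quasiVal_add_le_mul ξ ht hf hg0
    have h3 : c - quasiVal ξ t f ≤ quasiVal ξ t g := by
      refine le_quasiVal ξ hg0 fun i j hij => ?_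
      by_contra hlt
      push Not at hlt
      rw [← mem_belowWeight ht0] at hlt
      exact hij (congrFun hg ⟨_, hlt⟩)
    linarith

/-- For K large the coefficients below v(f) + v(g) are all realised in degree deg f + deg g + K.
Passing to `combos f g K` loses at most deg f deg g dimensions, and its two summands contribute at
most the counts below v(g) and below v(f). -/
theorem card_belowWeight_add_le (ξ : PowerSeries ℂ) {t : ℝ} (ht : 1 ≤ t)
    {f g : MvPolynomial (Fin 2) ℂ} (hf : f ≠ 0) (hg : g ≠ 0) (hfg : IsRelPrime f g) :
    ((belowWeight t (quasiVal ξ t f + quasiVal ξ t g)).card : ℝ) ≤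
      (belowWeight t (quasiVal ξ t f)).card + (belowWeight t (quasiVal ξ t g)).card +
        f.totalDegree * g.totalDegree := by
  set c := quasiVal ξ t f + quasiVal ξ t g with hc
  obtain ⟨K, hK⟩ := exists_map_coeffsAt_eq_top ξ (belowWeight t c)
  have h1 := finrank_map_add_finrank_le (coeffsAt ξ (belowWeight t c)) (combos_le f g K)
  rw [hK _ (by omega), finrank_top, Module.finrank_fintype_fun_eq_card, Fintype.card_coe] at h1
  have h2 := finrank_le_finrank_combos hf hg hfg K
  have h3 : Module.finrank ℂ ((combos f g K).map (coeffsAt ξ (belowWeight t c))) ≤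
      (belowWeight t (quasiVal ξ t g)).card + (belowWeight t (quasiVal ξ t f)).card := by
    rw [combos, Submodule.map_sup]
    refine (Submodule.finrank_add_le_finrank_add_finrank _ _).trans (add_le_add ?_ ?_)
    · have := finrank_map_map_mulLeft_le ξ ht hf c
        (MvPolynomial.restrictTotalDegree (Fin 2) ℂ (g.totalDegree + K))
      rwa [hc, add_sub_cancel_left, ← hc] at this
    · have := finrank_map_map_mulLeft_le ξ ht hg c
        (MvPolynomial.restrictTotalDegree (Fin 2) ℂ (f.totalDegree + K))
      rwa [hc, add_sub_cancel_right, ← hc] at this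
  have h1' : ((belowWeight t c).card : ℝ) + Module.finrank ℂ (combos f g K) ≤
      Module.finrank ℂ ((combos f g K).map (coeffsAt ξ (belowWeight t c))) +
      Module.finrank ℂ (MvPolynomial.restrictTotalDegree (Fin 2) ℂ
        (f.totalDegree + g.totalDegree + K)) := by exact_mod_cast h1
  have h3' : (Module.finrank ℂ ((combos f g K).map (coeffsAt ξ (belowWeight t c))) : ℝ) ≤
      (belowWeight t (quasiVal ξ t g)).card + (belowWeight t (quasiVal ξ t f)).card := by
    exact_mod_cast h3
  linarith

theorem quasiVal_nonneg (ξ : PowerSeries ℂ) {t : ℝ} (ht : 1 ≤ t) (f : MvPolynomial (Fin 2) ℂ) :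
    0 ≤ quasiVal ξ t f := by
  refine Real.sInf_nonneg ?_
  rintro s ⟨i, j, -, rfl⟩
  positivity

theorem quasiVal_one {ξ : PowerSeries ℂ} (hξ : PowerSeries.constantCoeff ξ = 0) {t : ℝ}
    (ht : 1 ≤ t) : quasiVal ξ t 1 = 0 := by
  have h := quasiVal_mul hξ ht (one_ne_zero (α := MvPolynomial (Fin 2) ℂ)) one_ne_zero
  rw [mul_one] at h
  linarith

theorem quasiVal_pow {ξ : PowerSeries ℂ} (hξ : PowerSeries.constantCoeff ξ = 0) {t : ℝ}
    (ht : 1 ≤ t) {f : MvPolynomial (Fin 2) ℂ} (hf : f ≠ 0) (n : ℕ) :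
    quasiVal ξ t (f ^ n) = n * quasiVal ξ t f := by
  induction n with
  | zero => simp [quasiVal_one hξ ht]
  | succ n ih =>
    rw [pow_succ, quasiVal_mul hξ ht (pow_ne_zero _ hf) hf, ih]
    push_cast; ring

/-- Bézout's bound: the local intersection number of two curves without common component, which
is at least `v(f) v(g) / t`, is at most the product of their degrees. -/
theorem quasiVal_mul_quasiVal_le {ξ : PowerSeries ℂ} (hξ : PowerSeries.constantCoeff ξ = 0)
    {t : ℝ} (ht : 1 ≤ t) {f g : MvPolynomial (Fin 2) ℂ} (hf : f ≠ 0) (hg : g ≠ 0)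
    (hfg : IsRelPrime f g) :
    quasiVal ξ t f * quasiVal ξ t g ≤ t * (f.totalDegree * g.totalDegree) := by
  have ht0 : 0 < t := by linarith
  by_contra! hlt
  set a := quasiVal ξ t f with ha
  set b := quasiVal ξ t g with hb
  set δ : ℝ := f.totalDegree * g.totalDegree with hδ
  have ha0 : 0 ≤ a := quasiVal_nonneg ξ ht f
  have hb0 : 0 ≤ b := quasiVal_nonneg ξ ht g
  have hε : 0 < a * b / t - δ := by
    rw [sub_pos, lt_div_iff₀ ht0]; linarith
  obtain ⟨M, hM⟩ := exists_nat_gt ((2 * (a + b) + 2 * t + 2) / (a * b / t - δ))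
  rw [div_lt_iff₀ hε] at hM
  have hM1 : (1 : ℝ) ≤ M := by
    rcases Nat.eq_zero_or_pos M with rfl | h
    · simp only [Nat.cast_zero, zero_mul] at hM; linarith
    · exact_mod_cast h
  have h1 := card_belowWeight_add_le ξ ht (pow_ne_zero M hf) (pow_ne_zero M hg)
    hfg.pow
  rw [quasiVal_pow hξ ht hf, quasiVal_pow hξ ht hg, ← ha, ← hb] at h1
  have hd : ∀ h : MvPolynomial (Fin 2) ℂ, ((h ^ M).totalDegree : ℝ) ≤ M * h.totalDegree := by
    intro h
    have := MvPolynomial.totalDegree_pow h M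
    exact_mod_cast this
  have h2 : ((f ^ M).totalDegree : ℝ) * (g ^ M).totalDegree ≤ M ^ 2 * δ := by
    have := mul_le_mul (hd f) (hd g) (Nat.cast_nonneg _) (by positivity)
    rw [hδ]
    linarith
  clear_value a b δ
  have h3 := le_card_belowWeight ht (c := M * a + M * b) (by positivity)
  have h4 := card_belowWeight_le ht (c := M * a) (by positivity)
  have h5 := card_belowWeight_le ht (c := M * b) (by positivity)
  have h6 : (M * a + M * b) ^ 2 / (2 * t) =
      (M * a) ^ 2 / (2 * t) + (M * b) ^ 2 / (2 * t) + M ^ 2 * (a * b / t) := by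
    field_simp; ring
  rw [h6] at h3
  generalize (M * a) ^ 2 / (2 * t) = A at h3 h4
  generalize (M * b) ^ 2 / (2 * t) = B at h3 h5
  generalize a * b / t = q at h3 hε hM
  have h7 : (M : ℝ) ^ 2 * (q - δ) ≤ M * (2 * (a + b)) + (2 * t + 2) := by
    rw [mul_sub]
    linarith
  have h8 := mul_lt_mul_of_pos_left hM (by linarith : (0 : ℝ) < M)
  have h9 : 1 * (2 * t + 2) ≤ (M : ℝ) * (2 * t + 2) := by gcongr
  have h10 : (M : ℝ) * (M * (q - δ)) = M ^ 2 * (q - δ) := by ring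
  linarith

/-! ### Curves with v(f) > deg(f) √t -/

theorem dvd_of_sqrt_lt_quasiVal {ξ : PowerSeries ℂ} (hξ : PowerSeries.constantCoeff ξ = 0)
    {t : ℝ} (ht : 1 ≤ t) {f g : MvPolynomial (Fin 2) ℂ} (hf : Irreducible f)
    (hfv : (f.totalDegree : ℝ) * Real.sqrt t < quasiVal ξ t f)
    (hgv : (g.totalDegree : ℝ) * Real.sqrt t < quasiVal ξ t g) : f ∣ g := by
  by_contra h
  have hg : g ≠ 0 := fun h0 => h (h0 ▸ dvd_zero f)
  have h1 := quasiVal_mul_quasiVal_le hξ ht hf.ne_zero hg (hf.isRelPrime_iff_not_dvd.mpr h)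
  have h2 : ((f.totalDegree : ℝ) * Real.sqrt t) * (g.totalDegree * Real.sqrt t) <
      quasiVal ξ t f * quasiVal ξ t g :=
    mul_lt_mul'' hfv hgv (by positivity) (by positivity)
  have h3 : Real.sqrt t * Real.sqrt t = t := Real.mul_self_sqrt (by linarith)
  have h4 : ((f.totalDegree : ℝ) * Real.sqrt t) * (g.totalDegree * Real.sqrt t) =
      (Real.sqrt t * Real.sqrt t) * (f.totalDegree * g.totalDegree) := by ring
  rw [h4, h3] at h2
  linarith

/-- The case f = 0 relies on the default value 0 of `sInf ∅`. It guarantees that a strict inequality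
deg(g) √t < `quasiVal ξ t g` never holds for g = 0. -/
theorem quasiVal_of_totalDegree_eq_zero (ξ : PowerSeries ℂ) {t : ℝ} (ht : 1 ≤ t)
    {f : MvPolynomial (Fin 2) ℂ} (hf : f.totalDegree = 0) : quasiVal ξ t f = 0 := by
  rcases eq_or_ne f 0 with rfl | h0
  · have : {s : ℝ | ∃ i j : ℕ, expansionCoeff ξ 0 i j ≠ 0 ∧ s = i + t * j} = ∅ := by
      ext s; simp [expansionCoeff]
    rw [quasiVal, this, Real.sInf_empty]
  · have := quasiVal_le_totalDegree ξ ht h0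
    rw [hf] at this
    refine le_antisymm (by simpa using this) (quasiVal_nonneg ξ ht f)

theorem totalDegree_pos_of_irreducible {f : MvPolynomial (Fin 2) ℂ} (hf : Irreducible f) :
    0 < f.totalDegree := by
  rw [Nat.pos_iff_ne_zero]
  intro h
  rw [MvPolynomial.totalDegree_eq_zero_iff_eq_C] at h
  have h0 : f.coeff 0 ≠ 0 := by
    intro h'
    rw [h', map_zero] at h
    exact hf.ne_zero h
  exact hf.not_isUnit (h ▸ (IsUnit.mk0 _ h0).map MvPolynomial.C)

/-- The powers of f keep the ratio of value to degree bound constant along the degrees (k + 1) deg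
f, and the limit may be taken along this subsequence. -/
theorem div_le_muHat {ξ : PowerSeries ℂ} (hξ : PowerSeries.constantCoeff ξ = 0) {t : ℝ}
    (ht : 1 ≤ t) {f : MvPolynomial (Fin 2) ℂ} (hf : f ≠ 0) (hd : 0 < f.totalDegree) :
    quasiVal ξ t f / f.totalDegree ≤ muHat ξ t := by
  have h1 : Tendsto (fun k : ℕ => (k + 1) * f.totalDegree) atTop atTop :=
    tendsto_atTop_mono (fun k => by nlinarith) (tendsto_add_atTop_nat 0)
  refine ge_of_tendsto' ((tendsto_muHat ξ ht).comp h1) fun k => ?_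
  have h2 := quasiVal_le_muDeg ξ ht (d := (k + 1) * f.totalDegree) (pow_ne_zero (k + 1) hf)
    (MvPolynomial.totalDegree_pow f (k + 1))
  rw [quasiVal_pow hξ ht hf] at h2
  have hd' : (0 : ℝ) < f.totalDegree := by exact_mod_cast hd
  simp only [Function.comp_apply]
  push_cast at h2 ⊢
  rw [div_le_div_iff₀ hd' (by positivity)]
  nlinarith

theorem muHat_le {ξ : PowerSeries ℂ} {t : ℝ} (ht : 1 ≤ t) {c : ℝ} (hc : 0 ≤ c)
    (h : ∀ g : MvPolynomial (Fin 2) ℂ, g ≠ 0 → quasiVal ξ t g ≤ c * g.totalDegree) :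
    muHat ξ t ≤ c := by
  refine le_of_tendsto (tendsto_muHat ξ ht) ?_
  filter_upwards [eventually_gt_atTop 0] with d hd
  rw [div_le_iff₀ (by exact_mod_cast hd)]
  refine muDeg_le ξ fun g hg hgd => (h g hg).trans ?_
  gcongr

/-- Write g = f^k h with f not dividing h. By divisibility v(h) ≤ deg h √t ≤ c deg h, where c =
v(f)/deg f; additivity gives v(g) ≤ c deg g, so no polynomial beats f. -/
theorem quasiVal_eq_muHat_mul {ξ : PowerSeries ℂ} (hξ : PowerSeries.constantCoeff ξ = 0)
    {t : ℝ} (ht : 1 ≤ t) {f : MvPolynomial (Fin 2) ℂ} (hf : Irreducible f)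
    (hfv : (f.totalDegree : ℝ) * Real.sqrt t < quasiVal ξ t f) :
    quasiVal ξ t f = muHat ξ t * f.totalDegree := by
  have hd := totalDegree_pos_of_irreducible hf
  have hd' : (0 : ℝ) < f.totalDegree := by exact_mod_cast hd
  have h1 := div_le_muHat hξ ht hf.ne_zero hd
  set c := quasiVal ξ t f / f.totalDegree with hc
  have hcv : quasiVal ξ t f = c * f.totalDegree := by rw [hc]; field_simp
  have hcs : Real.sqrt t ≤ c := by
    rw [hc, le_div_iff₀ hd']; linarith
  have hc0 : 0 ≤ c := (Real.sqrt_nonneg t).trans hcs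
  have h2 : muHat ξ t ≤ c := by
    refine muHat_le ht hc0 fun g hg => ?_
    obtain ⟨h, hgh, hfh⟩ :=
      (FiniteMultiplicity.of_not_isUnit hf.not_isUnit hg).exists_eq_pow_mul_and_not_dvd
    generalize multiplicity f g = k at hgh
    subst hgh
    have hh : h ≠ 0 := right_ne_zero_of_mul hg
    have hk : f ^ k ≠ 0 := pow_ne_zero k hf.ne_zero
    have h3 : quasiVal ξ t h ≤ h.totalDegree * Real.sqrt t := by
      by_contra hlt
      push Not at hlt
      exact hfh (dvd_of_sqrt_lt_quasiVal hξ ht hf hfv hlt)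
    have h4 : (f ^ k).totalDegree = k * f.totalDegree := by
      clear hfh hg hk h3
      induction k with
      | zero => simp
      | succ k ih =>
        rw [pow_succ, MvPolynomial.totalDegree_mul_of_isDomain (pow_ne_zero k hf.ne_zero)
          hf.ne_zero, ih]
        ring
    rw [quasiVal_mul hξ ht hk hh, quasiVal_pow hξ ht hf.ne_zero,
      MvPolynomial.totalDegree_mul_of_isDomain hk hh, h4, hcv]
    push_cast
    have h5 : (h.totalDegree : ℝ) * Real.sqrt t ≤ h.totalDegree * c := by gcongr
    linarith
  rw [hcv, le_antisymm h2 h1]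

/-- The quantity v(g) − deg(g) √t is additive over factors and not positive on units, so if it is
positive for g it is positive for some irreducible factor. -/
theorem exists_irreducible_of_sqrt_lt {ξ : PowerSeries ℂ}
    (hξ : PowerSeries.constantCoeff ξ = 0) {t : ℝ} (ht : 1 ≤ t) (g : MvPolynomial (Fin 2) ℂ)
    (hg : (g.totalDegree : ℝ) * Real.sqrt t < quasiVal ξ t g) :
    ∃ f : MvPolynomial (Fin 2) ℂ, Irreducible f ∧
      (f.totalDegree : ℝ) * Real.sqrt t < quasiVal ξ t f := by
  induction g using WfDvdMonoid.induction_on_irreducible with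
  | zero => simp [quasiVal_of_totalDegree_eq_zero ξ ht (f := 0) (by simp)] at hg
  | unit u hu =>
    rw [quasiVal_of_totalDegree_eq_zero ξ ht (MvPolynomial.isUnit_iff_totalDegree_of_isReduced.mp hu).2] at hg
    have : 0 ≤ (u.totalDegree : ℝ) * Real.sqrt t := by positivity
    linarith
  | mul a i ha hi ih =>
    by_cases h : (i.totalDegree : ℝ) * Real.sqrt t < quasiVal ξ t i
    · exact ⟨i, hi, h⟩
    · refine ih ?_
      rw [quasiVal_mul hξ ht hi.ne_zero ha,
        MvPolynomial.totalDegree_mul_of_isDomain hi.ne_zero ha] at hg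
      push_cast at hg
      linarith

theorem exists_irreducible_of_sqrt_lt_muHat {ξ : PowerSeries ℂ}
    (hξ : PowerSeries.constantCoeff ξ = 0) {t : ℝ} (ht : 1 ≤ t)
    (h : Real.sqrt t < muHat ξ t) :
    ∃ f : MvPolynomial (Fin 2) ℂ, Irreducible f ∧
      (f.totalDegree : ℝ) * Real.sqrt t < quasiVal ξ t f := by
  by_contra! hno
  refine absurd (muHat_le ht (Real.sqrt_nonneg t) fun g _ => ?_) (not_le.mpr h)
  by_contra! hlt
  obtain ⟨f, hf, hfv⟩ := exists_irreducible_of_sqrt_lt hξ ht g (by rwa [mul_comm])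
  exact absurd hfv (not_lt.mpr (hno f hf))

/-! ### Very general series -/

/-- The expansion of a polynomial along the series whose coefficients are indeterminates: the
variable `i` stands for the coefficient of `x^(i+1)`. -/
noncomputable def genericExpansion :
    MvPolynomial (Fin 2) ℂ →ₐ[ℂ] Polynomial (PowerSeries (MvPolynomial ℕ ℂ)) :=
  MvPolynomial.aeval ![Polynomial.C PowerSeries.X, Polynomial.X +
    Polynomial.C (PowerSeries.mk fun n => if n = 0 then 0 else MvPolynomial.X (n - 1))]

theorem map_genericExpansion {ξ : PowerSeries ℂ} (hξ : PowerSeries.constantCoeff ξ = 0)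
    (f : MvPolynomial (Fin 2) ℂ) :
    (genericExpansion f).map (PowerSeries.map
      (MvPolynomial.eval fun i => PowerSeries.coeff (i + 1) ξ)) = expansion ξ f := by
  induction f using MvPolynomial.induction_on with
  | C a =>
    simp [genericExpansion, expansion, IsScalarTower.algebraMap_apply ℂ (PowerSeries ℂ)
      (Polynomial (PowerSeries ℂ)), IsScalarTower.algebraMap_apply ℂ
      (PowerSeries (MvPolynomial ℕ ℂ)) (Polynomial (PowerSeries (MvPolynomial ℕ ℂ))),
      IsScalarTower.algebraMap_apply ℂ (MvPolynomial ℕ ℂ) (PowerSeries (MvPolynomial ℕ ℂ)),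
      MvPolynomial.algebraMap_eq]
  | add p q hp hq => simp [hp, hq]
  | mul_X p i hp =>
    rw [map_mul, map_mul, Polynomial.map_mul, hp]
    refine congrArg _ ?_
    clear hp
    fin_cases i
    · simp [genericExpansion, expansion]
    · simp only [genericExpansion, expansion, MvPolynomial.aeval_X, Fin.mk_one,
        Matrix.cons_val_one, Matrix.cons_val_fin_one, Polynomial.map_add, Polynomial.map_X,
        Polynomial.map_C]
      congr 2
      ext n
      rw [PowerSeries.coeff_map, PowerSeries.coeff_mk]
      rcases n with _ | n
      · simpa using hξ.symm
      · simp

/-- If the exponents in `S` impose independent conditions with trivial solution space on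
polynomials of degree at most `d` for one series, then they do so outside a hypersurface. -/
theorem exists_ne_zero_of_coeffsAt_injective (S : Finset (Σ _ : ℕ, ℕ)) (d : ℕ)
    {ξ₀ : PowerSeries ℂ} (hξ₀ : PowerSeries.constantCoeff ξ₀ = 0)
    (h₀ : ∀ f : MvPolynomial (Fin 2) ℂ, f.totalDegree ≤ d → coeffsAt ξ₀ S f = 0 → f = 0) :
    ∃ F : MvPolynomial ℕ ℂ, F ≠ 0 ∧ ∀ ξ : PowerSeries ℂ, PowerSeries.constantCoeff ξ = 0 →
      MvPolynomial.eval (fun i => PowerSeries.coeff (i + 1) ξ) F ≠ 0 →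
      ∀ f : MvPolynomial (Fin 2) ℂ, f.totalDegree ≤ d → coeffsAt ξ S f = 0 → f = 0 := by
  classical
  let P := MvPolynomial.restrictTotalDegree (Fin 2) ℂ d
  let b := Module.finBasis ℂ P
  let M : Matrix S (Fin (Module.finrank ℂ P)) (MvPolynomial ℕ ℂ) := fun s k =>
    PowerSeries.coeff s.1.2 ((genericExpansion (b k)).coeff s.1.1)
  have hM : ∀ ξ : PowerSeries ℂ, PowerSeries.constantCoeff ξ = 0 →
      M.map (MvPolynomial.eval fun i => PowerSeries.coeff (i + 1) ξ) =
        LinearMap.toMatrix b (Pi.basisFun ℂ S) ((coeffsAt ξ S).domRestrict P) := by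
    intro ξ hξ
    ext s k
    rw [LinearMap.toMatrix_apply, Pi.basisFun_repr, LinearMap.domRestrict_apply, coeffsAt_apply,
      expansionCoeff, ← map_genericExpansion hξ, Polynomial.coeff_map, PowerSeries.coeff_map]
    rfl
  have hker : LinearMap.ker ((coeffsAt ξ₀ S).domRestrict P) = ⊥ := by
    rw [LinearMap.ker_eq_bot']
    rintro ⟨f, hf⟩ hf0
    exact Subtype.ext (h₀ f ((MvPolynomial.mem_restrictTotalDegree _ _ _).mp hf) hf0)
  -- A left inverse at ξ₀ replaces the choice of a maximal minor of M: the square matrix N M has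
  -- determinant 1 at ξ₀, and a nonzero determinant at ξ forces injectivity there.
  obtain ⟨L, hL⟩ := LinearMap.exists_leftInverse_of_injective _ hker
  let N := LinearMap.toMatrix (Pi.basisFun ℂ S) b L
  have hev : ∀ ξ : PowerSeries ℂ, PowerSeries.constantCoeff ξ = 0 →
      MvPolynomial.eval (fun i => PowerSeries.coeff (i + 1) ξ)
        (N.map (MvPolynomial.C (σ := ℕ)) * M).det =
      (LinearMap.toMatrix b b (L ∘ₗ (coeffsAt ξ S).domRestrict P)).det := by
    intro ξ hξ
    rw [RingHom.map_det, RingHom.mapMatrix_apply, Matrix.map_mul, hM ξ hξ, Matrix.map_map,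
      LinearMap.toMatrix_comp b (Pi.basisFun ℂ S) b]
    congr 2
    ext i j
    simp [N]
  refine ⟨(N.map (MvPolynomial.C (σ := ℕ)) * M).det, ?_, ?_⟩
  · intro h
    have := hev ξ₀ hξ₀
    rw [h, map_zero, hL, LinearMap.toMatrix_id, Matrix.det_one] at this
    exact zero_ne_one this
  · intro ξ hξ hne f hfd hf
    rw [hev ξ hξ, LinearMap.det_toMatrix] at hne
    have hinj : LinearMap.ker (L ∘ₗ (coeffsAt ξ S).domRestrict P) = ⊥ := by
      by_contra hk
      exact hne (LinearMap.det_eq_zero_iff_ker_ne_bot.mpr hk)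
    have hmem : (⟨f, (MvPolynomial.mem_restrictTotalDegree _ _ _).mpr hfd⟩ : P) ∈
        LinearMap.ker (L ∘ₗ (coeffsAt ξ S).domRestrict P) := by
      rw [LinearMap.mem_ker, LinearMap.comp_apply, LinearMap.domRestrict_apply, hf, map_zero]
    rw [hinj, Submodule.mem_bot] at hmem
    exact congrArg Subtype.val hmem

/-- Although t is real, the conditions involve only a finite set of exponents and a degree, so they
are countable. If f had v_{ξ,t}(f) > μ_d(ξ₀, t), the functionals below weight v_{ξ,t}(f) would be
injective in degree ≤ d at ξ₀, hence at ξ, yet they kill f. -/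
theorem veryGeneral_muDeg_le : VeryGeneral (fun ξ => ∀ t : ℝ, 1 ≤ t → ∀ d : ℕ,
    ∀ ξ₀ : PowerSeries ℂ, PowerSeries.constantCoeff ξ₀ = 0 → muDeg ξ t d ≤ muDeg ξ₀ t d) := by
  classical
  have key : ∀ p : Finset (Σ _ : ℕ, ℕ) × ℕ, ∃ F : MvPolynomial ℕ ℂ, F ≠ 0 ∧
      ∀ ξ : PowerSeries ℂ, PowerSeries.constantCoeff ξ = 0 →
      MvPolynomial.eval (fun i => PowerSeries.coeff (i + 1) ξ) F ≠ 0 →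
      ∀ ξ₀ : PowerSeries ℂ, PowerSeries.constantCoeff ξ₀ = 0 →
      (∀ f : MvPolynomial (Fin 2) ℂ, f.totalDegree ≤ p.2 → coeffsAt ξ₀ p.1 f = 0 → f = 0) →
      ∀ f : MvPolynomial (Fin 2) ℂ, f.totalDegree ≤ p.2 → coeffsAt ξ p.1 f = 0 → f = 0 := by
    intro p
    by_cases h : ∃ ξ₀ : PowerSeries ℂ, PowerSeries.constantCoeff ξ₀ = 0 ∧
      ∀ f : MvPolynomial (Fin 2) ℂ, f.totalDegree ≤ p.2 → coeffsAt ξ₀ p.1 f = 0 → f = 0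
    · obtain ⟨ξ₀, hξ₀, h₀⟩ := h
      obtain ⟨F, hF, hF'⟩ := exists_ne_zero_of_coeffsAt_injective p.1 p.2 hξ₀ h₀
      exact ⟨F, hF, fun ξ hξ hne _ _ _ => hF' ξ hξ hne⟩
    -- No series has the injectivity, so nothing has to be transferred and the constant 1 serves.
    · exact ⟨1, one_ne_zero, fun ξ hξ _ ξ₀ hξ₀ h₀ => absurd ⟨ξ₀, hξ₀, h₀⟩ h⟩
  choose F hF hF' using key
  obtain ⟨e, he⟩ := exists_surjective_nat (Finset (Σ _ : ℕ, ℕ) × ℕ)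
  refine ⟨fun k => F (e k), fun k => hF _, fun ξ hξ hne t ht d ξ₀ hξ₀ => ?_⟩
  have ht0 : 0 < t := by linarith
  refine muDeg_le ξ fun f hf hfd => ?_
  by_contra! hlt
  obtain ⟨k, hk⟩ := he (belowWeight t (quasiVal ξ t f), d)
  have h1 := hF' (e k) ξ hξ (hne k) ξ₀ hξ₀
  rw [hk] at h1
  refine hf (h1 ?_ f hfd ?_)
  · intro g hgd hg
    by_contra hg0
    have h2 : quasiVal ξ t f ≤ quasiVal ξ₀ t g := by
      refine le_quasiVal ξ₀ hg0 fun i j hij => ?_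
      by_contra! h3
      rw [← mem_belowWeight ht0] at h3
      exact hij (congrFun hg ⟨_, h3⟩)
    linarith [quasiVal_le_muDeg ξ₀ ht hg0 hgd]
  · ext ⟨⟨j, i⟩, hs⟩
    by_contra h3
    have h3 : expansionCoeff ξ f i j ≠ 0 := h3
    rw [mem_belowWeight ht0] at hs
    linarith [quasiVal_le ξ ht h3]

theorem muHat_le_muHat {ξ ξ₀ : PowerSeries ℂ} {t : ℝ} (ht : 1 ≤ t)
    (h : ∀ d, muDeg ξ t d ≤ muDeg ξ₀ t d) : muHat ξ t ≤ muHat ξ₀ t := by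
  refine le_of_tendsto_of_tendsto' (tendsto_muHat ξ ht) (tendsto_muHat ξ₀ ht) fun d => ?_
  gcongr
  exact h d

theorem veryGeneral_muHat_eq :
    VeryGeneral (fun ξ => ∀ t : ℝ, 1 ≤ t → muHat ξ t = muHatGen t) := by
  obtain ⟨F, hF, h⟩ := veryGeneral_muDeg_le
  refine ⟨F, hF, fun ξ hξ hne t ht => ?_⟩
  have hmin : ∀ ξ₀ : {ξ : PowerSeries ℂ // PowerSeries.constantCoeff ξ = 0},
      muHat ξ t ≤ muHat ξ₀.1 t :=
    fun ξ₀ => muHat_le_muHat ht fun d => h ξ hξ hne t ht d ξ₀.1 ξ₀.2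
  have : Nonempty {ξ : PowerSeries ℂ // PowerSeries.constantCoeff ξ = 0} := ⟨⟨ξ, hξ⟩⟩
  refine le_antisymm (le_ciInf hmin) ?_
  exact ciInf_le (f := fun ξ₀ : {ξ : PowerSeries ℂ // PowerSeries.constantCoeff ξ = 0} =>
    muHat ξ₀.1 t) ⟨muHat ξ t, by rintro _ ⟨ξ₀, rfl⟩; exact hmin ξ₀⟩ ⟨ξ, hξ⟩

/-- On the line from b to a point where F does not vanish, F is a nonzero polynomial in one
variable; its finitely many roots cannot isolate b from the nonvanishing locus. -/
theorem dense_eval_ne_zero {F : MvPolynomial ℕ ℂ} (hF : F ≠ 0) :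
    Dense {a : ℕ → ℂ | MvPolynomial.eval a F ≠ 0} := by
  obtain ⟨a, ha⟩ : ∃ a, MvPolynomial.eval a F ≠ 0 := by
    by_contra! h
    exact hF (MvPolynomial.funext fun a => by simpa using h a)
  intro b
  let ℓ : ℂ → ℕ → ℂ := fun s i => b i + s * (a i - b i)
  let p : Polynomial ℂ := MvPolynomial.aeval
    (fun i => Polynomial.C (b i) + Polynomial.X * Polynomial.C (a i - b i)) F
  have hp : ∀ s, p.eval s = MvPolynomial.eval (ℓ s) F := by
    intro s
    have : (Polynomial.evalRingHom s).comp (MvPolynomial.aeval (R := ℂ)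
        (fun i => Polynomial.C (b i) + Polynomial.X * Polynomial.C (a i - b i))).toRingHom =
        MvPolynomial.eval (ℓ s) := by
      ext i <;> simp [ℓ]
    exact DFunLike.congr_fun this F
  have hp0 : p ≠ 0 := by
    intro h
    have := hp 1
    rw [h, Polynomial.eval_zero] at this
    apply ha
    simpa [ℓ] using this.symm
  have hfin : {s : ℂ | p.eval s = 0}.Finite := by
    refine p.roots.toFinset.finite_toSet.subset fun s hs => ?_
    simpa [hp0] using hs
  have hd : Dense ({s : ℂ | p.eval s = 0}ᶜ) := hfin.countable.dense_compl ℂ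
  have hc : Continuous ℓ := by fun_prop
  have h0 : b = ℓ 0 := by simp [ℓ]
  rw [h0]
  refine closure_mono ?_ (image_closure_subset_closure_image hc ⟨0, hd 0, rfl⟩)
  rintro _ ⟨s, hs, rfl⟩
  show MvPolynomial.eval (ℓ s) F ≠ 0
  rw [← hp]
  exact hs

/-- Baire's theorem in ℂ^ℕ with the product topology. This is what makes very general series exist.
-/
theorem exists_forall_eval_ne_zero (F : ℕ → MvPolynomial ℕ ℂ) (hF : ∀ k, F k ≠ 0) :
    ∃ a : ℕ → ℂ, ∀ k, MvPolynomial.eval a (F k) ≠ 0 := by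
  have h := dense_iInter_of_isOpen (f := fun k => {a : ℕ → ℂ | MvPolynomial.eval a (F k) ≠ 0})
    (fun k => isOpen_ne_fun (MvPolynomial.continuous_eval (F k)) continuous_const)
    fun k => dense_eval_ne_zero (hF k)
  obtain ⟨a, ha⟩ := h.nonempty
  exact ⟨a, fun k => Set.mem_iInter.mp ha k⟩

theorem VeryGeneral.exists_and {P Q : PowerSeries ℂ → Prop} (hP : VeryGeneral P)
    (hQ : VeryGeneral Q) : ∃ ξ, PowerSeries.constantCoeff ξ = 0 ∧ P ξ ∧ Q ξ := by
  obtain ⟨F, hF, hFP⟩ := hP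
  obtain ⟨G, hG, hGQ⟩ := hQ
  obtain ⟨a, ha⟩ := exists_forall_eval_ne_zero (fun k => F k * G k)
    fun k => mul_ne_zero (hF k) (hG k)
  let ξ : PowerSeries ℂ := PowerSeries.mk fun n => if n = 0 then 0 else a (n - 1)
  have hξ : PowerSeries.constantCoeff ξ = 0 := by
    simp [ξ, ← PowerSeries.coeff_zero_eq_constantCoeff_apply]
  have hc : (fun i => PowerSeries.coeff (i + 1) ξ) = a := by
    funext i; simp [ξ]
  refine ⟨ξ, hξ, hFP ξ hξ fun k => ?_, hGQ ξ hξ fun k => ?_⟩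
  · rw [hc]
    exact left_ne_zero_of_mul (by simpa only [map_mul] using ha k)
  · rw [hc]
    exact right_ne_zero_of_mul (by simpa only [map_mul] using ha k)

/-! ### Newton polygons of irreducible series -/

/-- The power series all of whose monomials have `(α, β)`-weight at least `k`. -/
def WeightGE (α β k : ℕ) (F : MvPowerSeries (Fin 2) ℂ) : Prop :=
  ∀ e : Fin 2 →₀ ℕ, α * e 0 + β * e 1 < k → MvPowerSeries.coeff e F = 0

namespace WeightGE

variable {α β k l : ℕ} {F G : MvPowerSeries (Fin 2) ℂ}

theorem mono (h : WeightGE α β k F) (hlk : l ≤ k) : WeightGE α β l F :=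
  fun e he => h e (he.trans_le hlk)

theorem add (hF : WeightGE α β k F) (hG : WeightGE α β k G) : WeightGE α β k (F + G) :=
  fun e he => by rw [map_add, hF e he, hG e he, add_zero]

theorem sub (hF : WeightGE α β k F) (hG : WeightGE α β k G) : WeightGE α β k (F - G) :=
  fun e he => by rw [map_sub, hF e he, hG e he, sub_zero]

theorem mul (hF : WeightGE α β k F) (hG : WeightGE α β l G) : WeightGE α β (k + l) (F * G) := by
  classical
  intro e he
  rw [MvPowerSeries.coeff_mul]
  refine Finset.sum_eq_zero ?_
  rintro ⟨a, b⟩ hab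
  rw [Finset.HasAntidiagonal.mem_antidiagonal] at hab
  obtain rfl : a + b = e := hab
  simp only [Finsupp.add_apply] at he
  by_cases h : α * a 0 + β * a 1 < k
  · rw [hF a h, zero_mul]
  · rw [hG b (by nlinarith), mul_zero]

end WeightGE

/-- The quotient of the part of `F` divisible by `x^p` by `x^p`. -/
noncomputable def shiftFst (p : ℕ) : MvPowerSeries (Fin 2) ℂ →ₗ[ℂ] MvPowerSeries (Fin 2) ℂ where
  toFun F := fun e => MvPowerSeries.coeff (e + Finsupp.single 0 p) F
  map_add' _ _ := rfl
  map_smul' _ _ := rfl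

theorem coeff_shiftFst (p : ℕ) (F : MvPowerSeries (Fin 2) ℂ) (e : Fin 2 →₀ ℕ) :
    MvPowerSeries.coeff e (shiftFst p F) = MvPowerSeries.coeff (e + Finsupp.single 0 p) F := rfl

/-- The quotient by `z^q` of the part of `F` which is divisible by `z^q` and whose monomials are
not divisible by `x^p`. -/
noncomputable def shiftSnd (p q : ℕ) :
    MvPowerSeries (Fin 2) ℂ →ₗ[ℂ] MvPowerSeries (Fin 2) ℂ where
  toFun F := fun e => if e 0 < p then MvPowerSeries.coeff (e + Finsupp.single 1 q) F else 0
  map_add' F G := by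
    ext e
    show (if e 0 < p then MvPowerSeries.coeff _ F + MvPowerSeries.coeff _ G else 0) =
      (if e 0 < p then MvPowerSeries.coeff _ F else 0) +
        (if e 0 < p then MvPowerSeries.coeff _ G else 0)
    split_ifs <;> simp
  map_smul' c F := by
    ext e
    show (if e 0 < p then c * MvPowerSeries.coeff _ F else 0) =
      c * (if e 0 < p then MvPowerSeries.coeff _ F else 0)
    split_ifs <;> simp

theorem coeff_shiftSnd (p q : ℕ) (F : MvPowerSeries (Fin 2) ℂ) (e : Fin 2 →₀ ℕ) :
    MvPowerSeries.coeff e (shiftSnd p q F) =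
      if e 0 < p then MvPowerSeries.coeff (e + Finsupp.single 1 q) F else 0 := rfl

theorem WeightGE.shiftFst {α β k : ℕ} {F : MvPowerSeries (Fin 2) ℂ} (h : WeightGE α β k F)
    (p : ℕ) : WeightGE α β (k - α * p) (shiftFst p F) := by
  intro e he
  rw [coeff_shiftFst]
  refine h _ ?_
  simp only [Finsupp.add_apply, Finsupp.single_apply, if_true, mul_add]
  simp
  omega

theorem WeightGE.shiftSnd {α β k : ℕ} {F : MvPowerSeries (Fin 2) ℂ} (h : WeightGE α β k F)
    (p q : ℕ) : WeightGE α β (k - β * q) (shiftSnd p q F) := by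
  intro e he
  rw [coeff_shiftSnd]
  split_ifs with h0
  · refine h _ ?_
    simp only [Finsupp.add_apply, Finsupp.single_apply, if_true, mul_add]
    simp
    omega
  · rfl

theorem X_pow_mul_shift_add {p q : ℕ} {F : MvPowerSeries (Fin 2) ℂ}
    (h : ∀ e : Fin 2 →₀ ℕ, e 0 < p → e 1 < q → MvPowerSeries.coeff e F = 0) :
    MvPowerSeries.X 0 ^ p * shiftFst p F + MvPowerSeries.X 1 ^ q * shiftSnd p q F = F := by
  classical
  ext e
  rw [map_add, MvPowerSeries.X_pow_eq, MvPowerSeries.X_pow_eq, MvPowerSeries.coeff_monomial_mul,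
    MvPowerSeries.coeff_monomial_mul, coeff_shiftFst, coeff_shiftSnd]
  have h0 : (e - Finsupp.single (1 : Fin 2) q : Fin 2 →₀ ℕ) 0 = e 0 := by simp
  rw [h0]
  by_cases hp : Finsupp.single (0 : Fin 2) p ≤ e
  · have hp' := Finsupp.single_le_iff.mp hp
    rw [if_pos hp, if_neg (by omega : ¬ e 0 < p), one_mul, tsub_add_cancel_of_le hp]
    simp
  · have hp' : ¬ p ≤ e 0 := fun h => hp (Finsupp.single_le_iff.mpr h)
    rw [if_neg hp, if_pos (by omega : e 0 < p), zero_add]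
    by_cases hq : Finsupp.single (1 : Fin 2) q ≤ e
    · rw [if_pos hq, one_mul, tsub_add_cancel_of_le hq]
    · have hq' : ¬ q ≤ e 1 := fun h => hq (Finsupp.single_le_iff.mpr h)
      rw [if_neg hq, h e (by omega) (by omega)]

/-- A contraction for the weight filtration has a fixed point. -/
theorem exists_fixedPoint_shift {α β p q : ℕ} (c : ℂ) {R : MvPowerSeries (Fin 2) ℂ}
    (hR : WeightGE α β (α * p + β * q + 1) R) :
    ∃ S, WeightGE α β (α * p + β * q + 1) S ∧
      S = R - (c • shiftFst p S) * shiftSnd p q S := by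
  let A : MvPowerSeries (Fin 2) ℂ →ₗ[ℂ] MvPowerSeries (Fin 2) ℂ := c • shiftFst p
  let B := shiftSnd p q
  have hA : ∀ {k F}, WeightGE α β k F → WeightGE α β (k - α * p) (A F) := by
    intro k F h e he
    show MvPowerSeries.coeff e (c • shiftFst p F) = 0
    rw [map_smul, h.shiftFst p e he, smul_zero]
  have hB : ∀ {k F}, WeightGE α β k F → WeightGE α β (k - β * q) (B F) := fun h => h.shiftSnd p q
  set w := α * p + β * q with hw
  let Φ : MvPowerSeries (Fin 2) ℂ → MvPowerSeries (Fin 2) ℂ := fun S => R - A S * B S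
  have hΦ : ∀ {S}, WeightGE α β (w + 1) S → WeightGE α β (w + 1) (Φ S) := fun {S} h =>
    hR.sub (((hA h).mul (hB h)).mono (by omega))
  -- A and B together lower weights by w, but the second factor of each product comes from a series
  -- of weight at least w + 1. The net gain is 1.
  have hcontr : ∀ {S S' k}, WeightGE α β (w + 1) S → WeightGE α β (w + 1) S' →
      WeightGE α β k (S - S') → WeightGE α β (k + 1) (Φ S - Φ S') := by
    intro S S' k hS hS' h
    have h' : WeightGE α β k (S' - S) := by
      intro e he
      rw [← neg_sub, map_neg, h e he, neg_zero]
    have : Φ S - Φ S' = A (S' - S) * B S' + A S * B (S' - S) := by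
      simp only [Φ, map_sub]; ring
    rw [this]
    exact (((hA h').mul (hB hS')).mono (by omega)).add (((hA hS).mul (hB h')).mono (by omega))
  let T : ℕ → MvPowerSeries (Fin 2) ℂ := fun n => Φ^[n] 0
  have hT : ∀ n, T (n + 1) = Φ (T n) := fun n => Function.iterate_succ_apply' Φ n 0
  have hTw : ∀ n, WeightGE α β (w + 1) (T n) := by
    intro n
    induction n with
    | zero => exact fun e _ => by simp [T]
    | succ n ih => rw [hT]; exact hΦ ih
  have hTs : ∀ n, WeightGE α β (w + 1 + n) (T (n + 1) - T n) := by
    intro n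
    induction n with
    | zero => exact ((hTw 1).sub (hTw 0)).mono (by omega)
    | succ n ih =>
      rw [hT (n + 1), hT n]
      rw [hT n] at ih
      have := hcontr (hΦ (hTw n)) (hTw n) ih
      exact this.mono (by omega)
  have hconst : ∀ (e : Fin 2 →₀ ℕ) n, α * e 0 + β * e 1 ≤ n →
      MvPowerSeries.coeff e (T n) = MvPowerSeries.coeff e (T (α * e 0 + β * e 1)) := by
    intro e n hn
    induction n, hn using Nat.le_induction with
    | base => rfl
    | succ n hn ih =>
      rw [← ih, ← sub_eq_zero, ← map_sub]
      exact hTs n e (by omega)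
  -- The limit of the iterates, coefficient by coefficient: at weight n the coefficient is constant
  -- from `T n` on.
  let S : MvPowerSeries (Fin 2) ℂ := fun e => MvPowerSeries.coeff e (T (α * e 0 + β * e 1))
  have hSc : ∀ e, MvPowerSeries.coeff e S = MvPowerSeries.coeff e (T (α * e 0 + β * e 1)) :=
    fun e => rfl
  have hST : ∀ n, WeightGE α β (n + 1) (S - T n) := by
    intro n e he
    rw [map_sub, hSc, hconst e n (by omega), sub_self]
  have hS : WeightGE α β (w + 1) S := fun e he => hTw _ e he
  refine ⟨S, hS, ?_⟩
  show S = Φ S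
  ext e
  set n := α * e 0 + β * e 1 with hn
  have h1 : WeightGE α β (n + 1) (T (n + 1) - Φ S) := by
    rw [hT]
    refine (hcontr (hTw n) hS (k := n + 1) ?_).mono (by omega)
    intro e he
    rw [← neg_sub, map_neg, hST n e he, neg_zero]
  have h2 := h1 e (by omega)
  rw [map_sub, sub_eq_zero] at h2
  rw [← h2, hSc, hconst e (n + 1) (by omega)]

/-- A power series whose Newton polygon has a vertex off the axes is reducible. -/
theorem not_irreducible_of_vertex {α β : ℕ} {φ : MvPowerSeries (Fin 2) ℂ} {a : Fin 2 →₀ ℕ}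
    (h0 : a 0 ≠ 0) (h1 : a 1 ≠ 0) (ha : MvPowerSeries.coeff a φ ≠ 0)
    (h : ∀ e, MvPowerSeries.coeff e φ ≠ 0 → e ≠ a →
      α * a 0 + β * a 1 < α * e 0 + β * e 1) : ¬ Irreducible φ := by
  classical
  set p := a 0
  set q := a 1
  set c := MvPowerSeries.coeff a φ with hc
  have hmon : (MvPowerSeries.monomial a c : MvPowerSeries (Fin 2) ℂ) =
      c • (MvPowerSeries.X 0 ^ p * MvPowerSeries.X 1 ^ q) := by
    rw [MvPowerSeries.X_pow_eq, MvPowerSeries.X_pow_eq, MvPowerSeries.monomial_mul_monomial,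
      ← map_smul, one_mul, smul_eq_mul, mul_one]
    congr 2
    ext i; fin_cases i <;> simp [p, q]
  have hR : WeightGE α β (α * p + β * q + 1) (φ - MvPowerSeries.monomial a c) := by
    intro e he
    rw [map_sub, MvPowerSeries.coeff_monomial]
    split_ifs with hea
    · rw [hea, hc, sub_self]
    · rw [sub_zero]
      by_contra hne
      have := h e hne hea
      omega
  obtain ⟨S, hS, hfix⟩ := exists_fixedPoint_shift c⁻¹ hR
  have hdec := X_pow_mul_shift_add (p := p) (q := q) (F := S) fun e hp hq => hS e (by
    have := Nat.mul_le_mul_left α hp.le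
    have := Nat.mul_le_mul_left β hq.le
    omega)
  set A := shiftFst p S with hA
  set B := shiftSnd p q S with hB
  -- The product expands to c x^p z^q + (x^p A + z^q B) + c⁻¹ A B, where the bracket is S. The
  -- fixed-point equation says exactly that S + c⁻¹ A B is the remainder φ − c x^p z^q.
  have hfac : φ = (c • MvPowerSeries.X 0 ^ p + B) * (MvPowerSeries.X 1 ^ q + c⁻¹ • A) := by
    have h2 : φ = c • (MvPowerSeries.X 0 ^ p * MvPowerSeries.X 1 ^ q) + S + (c⁻¹ • A) * B := by
      rw [← hmon]
      linear_combination -hfix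
    have h3 : (c • MvPowerSeries.X 0 ^ p) * (c⁻¹ • A) = MvPowerSeries.X 0 ^ p * A := by
      rw [smul_mul_smul_comm, mul_inv_cancel₀ ha, one_smul]
    rw [h2]
    nth_rewrite 1 [← hdec]
    rw [← h3, ← smul_mul_assoc]
    ring
  have hnu : ∀ F : MvPowerSeries (Fin 2) ℂ, MvPowerSeries.coeff 0 F = 0 → ¬ IsUnit F := by
    intro F hF hu
    rw [MvPowerSeries.isUnit_iff_constantCoeff, ← MvPowerSeries.coeff_zero_eq_constantCoeff_apply,
      hF] at hu
    exact not_isUnit_zero hu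
  intro hirr
  rcases hirr.isUnit_or_isUnit hfac with hu | hu
  · refine hnu _ ?_ hu
    rw [map_add, map_smul, (hS.shiftSnd p q) 0 (by simp)]
    simp [h0]
  · refine hnu _ ?_ hu
    rw [map_add, map_smul, (hS.shiftFst p) 0 (by simp)]
    simp [h1]

/-- The Newton polygon of an irreducible series has no vertex off the axes, so that every weight
takes its smallest value on the support at a point of the axes. -/
theorem IsLexMin.eq_zero_or_eq_zero_of_irreducible {t : ℝ} (ht : 0 < t)
    {φ : MvPowerSeries (Fin 2) ℂ} (hφ : Irreducible φ) {a : Fin 2 →₀ ℕ} (ha : IsLexMin t φ a) :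
    a 0 = 0 ∨ a 1 = 0 := by
  by_contra! hne
  have hfin : {e : Fin 2 →₀ ℕ | (e 0 + (t + 1) * e 1 : ℝ) ≤ a 0 + (t + 1) * a 1}.Finite :=
    finite_weight_le (by linarith) _
  -- Raising t slightly makes a the unique minimum: ties at t have larger second exponent and become
  -- strictly heavier. Exponents heavier than a at both t and t + 1 stay so in between, leaving
  -- finitely many to control by continuity.
  have hev : ∀ᶠ u in 𝓝[>] t, ∀ e : Fin 2 →₀ ℕ, MvPowerSeries.coeff e φ ≠ 0 → e ≠ a →
      (a 0 + u * a 1 : ℝ) < e 0 + u * e 1 := by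
    have h1 : ∀ᶠ u in 𝓝[>] t,
        ∀ e ∈ {e : Fin 2 →₀ ℕ | (e 0 + (t + 1) * e 1 : ℝ) ≤ a 0 + (t + 1) * a 1},
          (a 0 + t * a 1 : ℝ) < e 0 + t * e 1 → (a 0 + u * a 1 : ℝ) < e 0 + u * e 1 := by
      rw [eventually_all_finite hfin]
      intro e _
      by_cases h : (a 0 + t * a 1 : ℝ) < e 0 + t * e 1
      · have hc1 : Continuous fun u : ℝ => (a 0 + u * a 1 : ℝ) := by fun_prop
        have hc2 : Continuous fun u : ℝ => (e 0 + u * e 1 : ℝ) := by fun_prop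
        have := (hc1.tendsto t).eventually_lt (hc2.tendsto t) h
        filter_upwards [nhdsWithin_le_nhds this] with u hu _ using hu
      · exact Eventually.of_forall fun u h' => absurd h' h
    have h2 : ∀ᶠ u in 𝓝[>] t, u < t + 1 :=
      nhdsWithin_le_nhds (eventually_lt_nhds (by linarith))
    filter_upwards [h1, h2, self_mem_nhdsWithin] with u hu1 hu2 hu3 e he hea
    have hu3 : t < u := hu3
    rcases ha.2 e he with hlt | ⟨heq, hle⟩
    · by_cases hmem : (e 0 + (t + 1) * e 1 : ℝ) ≤ a 0 + (t + 1) * a 1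
      · exact hu1 e hmem hlt
      · push Not at hmem
        nlinarith
    · rcases hle.lt_or_eq with hlt | heq1
      · have : (a 1 : ℝ) < e 1 := by exact_mod_cast hlt
        nlinarith
      · exfalso
        apply hea
        have h00 : (a 0 : ℝ) = e 0 := by rw [heq1] at heq; linarith
        have h00 : a 0 = e 0 := by exact_mod_cast h00
        ext i; fin_cases i
        · exact h00.symm
        · exact heq1.symm
  obtain ⟨v, hv, hsub⟩ := mem_nhdsGT_iff_exists_Ioo_subset.mp hev
  -- A rational slope in this range gives natural weights after clearing its denominator, as the
  -- contraction argument requires.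
  obtain ⟨r, hr1, hr2⟩ := exists_rat_btwn (show t < v from hv)
  have hr := hsub ⟨hr1, hr2⟩
  have hr0 : (0 : ℚ) < r := by exact_mod_cast ht.trans hr1
  have hnum : ((r.num.toNat : ℕ) : ℝ) = r.num := by
    have := Int.toNat_of_nonneg (Rat.num_nonneg.mpr hr0.le)
    exact_mod_cast congrArg (Int.cast (R := ℝ)) this
  have hrq : (r : ℝ) = r.num.toNat / r.den := by
    rw [hnum]; exact Rat.cast_def r
  have hden : (0 : ℝ) < r.den := by exact_mod_cast r.den_pos
  refine not_irreducible_of_vertex (α := r.den) (β := r.num.toNat) hne.1 hne.2 ha.1 ?_ hφ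
  intro e he hea
  have h3 : (a 0 + (r : ℝ) * a 1 : ℝ) < e 0 + r * e 1 := hr e he hea
  have h4 := mul_lt_mul_of_pos_left h3 hden
  have h5 : (r.den : ℝ) * r = r.num.toNat := by rw [hrq]; field_simp
  have h6 : ∀ x y : ℝ, (r.den : ℝ) * (x + r * y) = r.den * x + r.num.toNat * y := by
    intro x y; rw [← h5]; ring
  rw [h6, h6] at h4
  exact_mod_cast h4

/-! ### The value of a branch and of a curve with given branches -/

theorem coeff_subst_X_zero (G : MvPowerSeries (Fin 2) ℂ) (i : ℕ) :
    PowerSeries.coeff i (MvPowerSeries.subst ![(PowerSeries.X : PowerSeries ℂ), 0] G :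
      PowerSeries ℂ) = MvPowerSeries.coeff (Finsupp.single 0 i) G := by
  have hs : MvPowerSeries.HasSubst ![(PowerSeries.X : PowerSeries ℂ), 0] :=
    MvPowerSeries.hasSubst_of_constantCoeff_zero fun s => by
      fin_cases s
      · exact PowerSeries.constantCoeff_X
      · exact map_zero _
  have h := MvPowerSeries.coeff_subst hs G (Finsupp.single () i)
  have hterm : ∀ d : Fin 2 →₀ ℕ, MvPowerSeries.coeff (Finsupp.single () i)
      (d.prod fun s e => (![(PowerSeries.X : PowerSeries ℂ), 0] s) ^ e) =
      if d = Finsupp.single 0 i then 1 else 0 := by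
    intro d
    rw [Finsupp.prod_fintype _ _ (by simp), Fin.prod_univ_two]
    show PowerSeries.coeff i ((PowerSeries.X : PowerSeries ℂ) ^ d 0 * 0 ^ d 1) = _
    by_cases h1 : d 1 = 0
    · rw [h1, pow_zero, mul_one, PowerSeries.coeff_X_pow]
      have : i = d 0 ↔ d = Finsupp.single 0 i := by
        constructor
        · intro h; ext s; fin_cases s <;> simp [h, h1]
        · intro h; rw [h]; simp
      simp [this]
    · rw [zero_pow h1, mul_zero, map_zero, if_neg]
      intro h; rw [h] at h1; simp at h1
  rw [finsum_eq_single _ (Finsupp.single 0 i)] at h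
  · rw [hterm, if_pos rfl, smul_eq_mul, mul_one] at h
    exact h
  · intro d hd
    rw [hterm, if_neg hd, smul_zero]

/-- Shearing and then setting z = 0 is the substitution y = ξ(x), so m can be read off the x-axis of
the sheared series. -/
theorem coeff_subst_shear_single {ξ : PowerSeries ℂ} (hξ : PowerSeries.constantCoeff ξ = 0)
    (φ : MvPowerSeries (Fin 2) ℂ) (i : ℕ) :
    MvPowerSeries.coeff (Finsupp.single 0 i) (MvPowerSeries.subst (shear ξ) φ) =
      PowerSeries.coeff i
        (MvPowerSeries.subst ![(PowerSeries.X : PowerSeries ℂ), ξ] φ : PowerSeries ℂ) := by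
  have hs : MvPowerSeries.HasSubst ![(PowerSeries.X : PowerSeries ℂ), 0] :=
    MvPowerSeries.hasSubst_of_constantCoeff_zero fun s => by
      fin_cases s
      · exact PowerSeries.constantCoeff_X
      · exact map_zero _
  rw [← coeff_subst_X_zero, MvPowerSeries.subst_comp_subst_apply (hasSubst_shear hξ) hs]
  congr 2
  have hX : MvPowerSeries.subst ![(PowerSeries.X : PowerSeries ℂ), 0]
      (MvPowerSeries.X 0 : MvPowerSeries (Fin 2) ℂ) = PowerSeries.X := by
    rw [MvPowerSeries.subst_X hs]; rfl
  have h0 : PowerSeries.HasSubst (MvPowerSeries.X 0 : MvPowerSeries (Fin 2) ℂ) :=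
    PowerSeries.HasSubst.X 0
  funext s
  fin_cases s
  · exact hX
  · show MvPowerSeries.subst ![(PowerSeries.X : PowerSeries ℂ), 0]
      (MvPowerSeries.X 1 + PowerSeries.subst (MvPowerSeries.X 0) ξ) = ξ
    rw [MvPowerSeries.subst_add hs, MvPowerSeries.subst_X hs, PowerSeries.subst,
      MvPowerSeries.subst_comp_subst_apply h0.const hs]
    simp only [hX]
    rw [← PowerSeries.subst_def, PowerSeries.X_subst]
    simp

/-- A monomial of degree n has weight at most n t because t ≥ 1, and x^m occurs. Conversely the
minimal monomial lies on an axis: it is z^j with j ≥ n or x^i with i ≥ m. -/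
theorem monVal_subst_shear_of_irreducible {ξ : PowerSeries ℂ}
    (hξ : PowerSeries.constantCoeff ξ = 0) {t : ℝ} (ht : 1 ≤ t) {φ : MvPowerSeries (Fin 2) ℂ}
    (hφ : Irreducible φ) {m n : ℕ}
    (hm : PowerSeries.order (MvPowerSeries.subst ![(PowerSeries.X : PowerSeries ℂ), ξ] φ :
      PowerSeries ℂ) = m) (hn : MvPowerSeries.order φ = n) :
    monVal t (MvPowerSeries.subst (shear ξ) φ) = min ((n : ℝ) * t) m := by
  have ht0 : 0 < t := by linarith
  set ψ := MvPowerSeries.subst (shear ξ) φ with hψ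
  have hψirr : Irreducible ψ := (MulEquiv.irreducible_iff (shearEquiv ξ hξ)).mpr hφ
  obtain ⟨a, ha⟩ := exists_isLexMin ht0 hψirr.ne_zero
  have hn' : ψ.order = n := by rw [hψ, order_subst_shear hξ, hn]
  rw [ha.monVal_eq]
  refine le_antisymm (le_min ?_ ?_) ?_
  · obtain ⟨e, he, hdeg⟩ := MvPowerSeries.exists_coeff_ne_zero_and_order (f := ψ) (by simp [hn'])
    rw [hn', Nat.cast_inj, Finsupp.degree_eq_sum, Fin.sum_univ_two] at hdeg
    refine (ha.le he).trans ?_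
    have h1 : (e 0 + e 1 : ℝ) = n := by exact_mod_cast hdeg
    have h2 : (0 : ℝ) ≤ e 0 := by positivity
    rw [← h1]
    nlinarith
  · have h1 := (PowerSeries.order_eq_nat.mp hm).1
    rw [← coeff_subst_shear_single hξ] at h1
    simpa using ha.le h1
  · rcases ha.eq_zero_or_eq_zero_of_irreducible ht0 hψirr with h0 | h1
    · have h2 := MvPowerSeries.order_le ha.1
      rw [hn', Nat.cast_le, Finsupp.degree_eq_sum, Fin.sum_univ_two, h0, zero_add] at h2
      refine (min_le_left _ _).trans ?_
      have h3 : (n : ℝ) ≤ a 1 := by exact_mod_cast h2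
      rw [h0, Nat.cast_zero, zero_add, mul_comm]
      gcongr
    · refine (min_le_right _ _).trans ?_
      have h2 : a = Finsupp.single 0 (a 0) := by
        ext s; fin_cases s <;> simp [h1]
      have h3 := ha.1
      rw [h2, coeff_subst_shear_single hξ] at h3
      have h4 : m ≤ a 0 := by
        by_contra! hlt
        exact h3 ((PowerSeries.order_eq_nat.mp hm).2 _ hlt)
      rw [h1, Nat.cast_zero, mul_zero, add_zero]
      exact_mod_cast h4

theorem HasBranchData.quasiVal_eq {ξ : PowerSeries ℂ} (hξ : PowerSeries.constantCoeff ξ = 0)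
    {t : ℝ} (ht : 1 ≤ t) {f : MvPolynomial (Fin 2) ℂ} {r : ℕ} {m n : Fin r → ℕ}
    (h : HasBranchData ξ f m n) : quasiVal ξ t f = tropicalMu m n t := by
  obtain ⟨φ, hf, hφ⟩ := h
  have hprod : MvPowerSeries.subst (shear ξ) (∏ i, φ i) =
      ∏ i, MvPowerSeries.subst (shear ξ) (φ i) := map_prod (shearEquiv ξ hξ) φ _
  rw [quasiVal_eq_monVal hξ, hf, hprod, monVal_prod (by linarith) _ _ fun i _ =>
    subst_shear_ne_zero hξ (hφ i).1.ne_zero, tropicalMu]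
  exact Finset.sum_congr rfl fun i _ =>
    monVal_subst_shear_of_irreducible hξ ht (hφ i).1 (hφ i).2.1 (hφ i).2.2
theorem mainTheorem9 :
    -- supraminimal curves of a given valuation `v_{ξ,t}`
    (∀ ξ : PowerSeries ℂ, PowerSeries.constantCoeff ξ = 0 → ∀ t : ℝ, 1 ≤ t →
      (∀ f : MvPolynomial (Fin 2) ℂ, Irreducible f →
        (f.totalDegree : ℝ) * Real.sqrt t < quasiVal ξ t f →
          (∀ g : MvPolynomial (Fin 2) ℂ,
            (g.totalDegree : ℝ) * Real.sqrt t < quasiVal ξ t g → f ∣ g) ∧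
          quasiVal ξ t f = muHat ξ t * (f.totalDegree : ℝ)) ∧
      (Real.sqrt t < muHat ξ t →
        ∃ f : MvPolynomial (Fin 2) ℂ, Irreducible f ∧
          (f.totalDegree : ℝ) * Real.sqrt t < quasiVal ξ t f)) ∧
    -- `μ̂(t)` is the value of `μ̂(ξ, t)` at very general `ξ`
    VeryGeneral (fun ξ => ∀ t : ℝ, 1 ≤ t → muHat ξ t = muHatGen t) ∧
    -- the consequence for very general valuations
    (∀ (d r : ℕ) (m n : Fin r → ℕ), (∀ i, Nat.gcd (m i) (n i) = 1) →
      VeryGeneral (fun ξ => ∃ f : MvPolynomial (Fin 2) ℂ,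
        Irreducible f ∧ f.totalDegree = d ∧ HasBranchData ξ f m n) →
      ∀ t : ℝ, 1 ≤ t →
        tropicalMu m n t / (d : ℝ) ≤ muHatGen t ∧
        ((d : ℝ) * Real.sqrt t < tropicalMu m n t →
          muHatGen t = tropicalMu m n t / (d : ℝ))) := by

  refine ⟨fun ξ hξ t ht => ⟨fun f hf hfv => ⟨fun g hgv => dvd_of_sqrt_lt_quasiVal hξ ht hf hfv hgv,
    quasiVal_eq_muHat_mul hξ ht hf hfv⟩, exists_irreducible_of_sqrt_lt_muHat hξ ht⟩,
    veryGeneral_muHat_eq, fun d r m n _ h t ht => ?_⟩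
  -- Neither μ_f(t)/d nor μ̂(t) depends on ξ, so one series that is very general for both properties
  -- is enough.
  obtain ⟨ξ, hξ, ⟨f, hf, rfl, hbr⟩, hgen⟩ := h.exists_and veryGeneral_muHat_eq
  have hd := totalDegree_pos_of_irreducible hf
  rw [← hgen t ht, ← hbr.quasiVal_eq hξ ht]
  refine ⟨div_le_muHat hξ ht hf.ne_zero hd, fun hfv => ?_⟩
  rw [quasiVal_eq_muHat_mul hξ ht hf hfv, mul_div_cancel_right₀]
  exact_mod_cast hd.ne'
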